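/- **Consistency of the variational estimator of $\pi$ in the stochastic block model.** *Model.* Fix an integer $Q$ and constants $\zeta>0$, $0<\gamma<1/Q$. Let $\alpha^*=(\alpha^*_1,\dots,\alpha^*_Q)$ be a probability vector and $\pi^*\in[0,1]^{Q\times Q}$. Labels $(Z_i)_{i}$ are i.i.d. with $\mathbb P(Z_i=q)=\alpha^*_q$, and, given the labels, the entries $X_{i,j}$ ($i\ne j$) of the directed adjacency matrix are independent Bernoulli variables with parameters $\pi^*_{Z_i,Z_j}$, while $X_{i,i}=0$. Write $X_{[n]}$ for the adjacency matrix of the first $n$ vertices. *Assumptions.* For a probability vector $\alpha$ and $\pi\in[0,1]^{Q\times Q}$ consider * (A1) for all $q\neq q'$ there is $l$ with $\pi_{q,l}\neq\pi_{q',l}$ or $\pi_{l,q}\neq\pi_{l,q'}$; * (A2) for all $q,l$: $\pi_{q,l}\in(0,1)$ implies $\pi_{q,l}\in[\zeta,1-\zeta]$; * (A3) $\alpha_q\in[\gamma,1-\gamma]$ for all $q$. Assume that $(\alpha^*,\pi^*)$ satisfies (A1), (A2) and (A3), and let the parameter set $\Theta$ be the set of all $(\alpha,\pi)$ satisfying (A1)–(A3),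 or the set of all $(\alpha,\pi)$ satisfying (A2)–(A3), or any set between these two. *Variational criterion.* With $\log 0=-\infty$ and $0\cdot(-\infty)=0$, put $$\mathcal L_1(X_{[n]};z,\pi)=\sum_{i\ne j}\{X_{i,j}\log\pi_{z_i,z_j}+(1-X_{i,j})\log(1-\pi_{z_i,z_j})\},\qquad \mathcal L_2(X_{[n]};\alpha,\pi)=\log\sum_{z\in\{1,\dots,Q\}^n}e^{\mathcal L_1(X_{[n]};z,\pi)}\prod_{i=1}^n\alpha_{z_i}.$$ For $\tau=(\tau_1,\dots,\tau_n)$ a family of probability vectors on $\{1,\dots,Q\}$ let $D_\tau=\bigotimes_{i}\tau_i$ be the product distribution on $\{1,\dots,Q\}^n$, and let $$\mathcal J(X_{[n]};\tau,\alpha,\pi)=\mathcal L_2(X_{[n]};\alpha,\pi)-K\big(D_\tau,\mathbb P_{\alpha,\pi}(Z_{[n]}=\cdot\mid X_{[n]})\big),$$ where $K$ is the Kullback–Leibler divergence ($\mathcal J=-\infty$ if $\mathcal L_2=-\infty$), and $$J_n(\alpha,\pi)=\frac1{n(n-1)}\max_\tau\mathcal J(X_{[n]};\tau,\alpha,\pi).$$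 *Conclusion.* Let $(\widetilde\alpha_n,\widetilde\pi_n)$ be a variational estimator, that is, $(\widetilde\alpha_n,\widetilde\pi_n)\in\operatorname{argmax}_{(\alpha,\pi)\in\Theta}J_n(\alpha,\pi)$ whenever this set of maximizers is non-empty. Then $\widetilde\pi_n$ is consistent up to label switching: for every distance $d$ on $[0,1]^{Q\times Q}$ that is continuous for the usual topology, $$\min_{\sigma\in\mathfrak S_Q}d\big(\widetilde\pi_n^{\sigma},\pi^*\big)\xrightarrow[n\to\infty]{\mathbb P}0,\qquad\text{where }\pi^\sigma_{q,l}=\pi_{\sigma(q),\sigma(l)}.$$ -/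

import Mathlib

open MeasureTheory

noncomputable section

namespace SBM

/-- A connectivity matrix `π` between `Q` classes, with entries in `[0,1]`. -/
abbrev Connectivity (Q : ℕ) : Type := Fin Q → Fin Q → unitInterval

/-- The parameters `(α, π)` of a stochastic block model with `Q` classes. -/
abbrev Param (Q : ℕ) : Type := (Fin Q → ℝ) × Connectivity Q

/-- (A1): no two classes have the same connectivity. -/
def A1 {Q : ℕ} (π : Connectivity Q) : Prop :=
  ∀ q q' : Fin Q, q ≠ q' → ∃ l : Fin Q, π q l ≠ π q' l ∨ π l q ≠ π l q'

/-- (A2): entries in the open interval `(0,1)` belong to `[ζ, 1 - ζ]`. -/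
def A2 {Q : ℕ} (ζ : ℝ) (π : Connectivity Q) : Prop :=
  ∀ q l : Fin Q, (π q l : ℝ) ∈ Set.Ioo (0 : ℝ) 1 → (π q l : ℝ) ∈ Set.Icc ζ (1 - ζ)

/-- (A3): the class proportions belong to `[γ, 1 - γ]`. -/
def A3 {Q : ℕ} (γ : ℝ) (α : Fin Q → ℝ) : Prop :=
  ∀ q : Fin Q, α q ∈ Set.Icc γ (1 - γ)

/-- Parameters `(α, π)`, with `α` a probability vector, fulfilling (A2) and (A3). -/
def paramA23 (Q : ℕ) (ζ γ : ℝ) : Set (Param Q) :=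
  {θ | θ.1 ∈ stdSimplex ℝ (Fin Q) ∧ A2 ζ θ.2 ∧ A3 γ θ.1}

/-- Parameters `(α, π)`, with `α` a probability vector, fulfilling (A1), (A2) and (A3). -/
def paramA123 (Q : ℕ) (ζ γ : ℝ) : Set (Param Q) :=
  {θ | θ ∈ paramA23 Q ζ γ ∧ A1 θ.2}

/-- Relabelling of the classes: `(π^σ)_{q,l} = π_{σ(q),σ(l)}`. -/
def relabel {Q : ℕ} (σ : Equiv.Perm (Fin Q)) (π : Connectivity Q) : Connectivity Q :=
  fun q l => π (σ q) (σ l)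

/-- `Z` (labels) and `X` (adjacency matrix, `true` for an edge) form a directed stochastic block
model on the vertices `0, 1, 2, …` with parameters `(α, π)`: there are no loops, the labels are
i.i.d. with law `α`, and given the labels the entries `X i j`, `i ≠ j`, are independent
Bernoulli variables of parameters `π (Z i) (Z j)`. -/
structure IsSBM {Ω : Type*} [MeasurableSpace Ω] (μ : Measure Ω) {Q : ℕ}
    (α : Fin Q → ℝ) (π : Connectivity Q)
    (Z : ℕ → Ω → Fin Q) (X : ℕ → ℕ → Ω → Bool) : Prop where
  measurable_label : ∀ i, Measurable (Z i)
  measurable_edge : ∀ i j, Measurable (X i j)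
  no_loop : ∀ i ω, X i i ω = false
  law : ∀ (n : ℕ) (z : Fin n → Fin Q) (x : Fin n → Fin n → Bool), (∀ i, x i i = false) →
    μ {ω | (∀ i : Fin n, Z i ω = z i) ∧ ∀ i j : Fin n, X i j ω = x i j} =
      ENNReal.ofReal ((∏ i : Fin n, α (z i)) *
        ∏ p ∈ (Finset.univ : Finset (Fin n)).offDiag,
          if x p.1 p.2 then (π (z p.1) (z p.2) : ℝ) else 1 - (π (z p.1) (z p.2) : ℝ))

/-- The observed adjacency matrix `X_[n]` of the first `n` vertices. -/
def observed {Ω : Type*} (X : ℕ → ℕ → Ω → Bool) (n : ℕ) (ω : Ω) : Fin n → Fin n → Bool :=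
  fun i j => X i j ω

/-- `x log p + (1 - x) log (1 - p)` for `x ∈ {0,1}`, in the extended reals, with `log 0 = -∞` and
`0 * (-∞) = 0`. -/
def edgeLogLik (x : Bool) (p : unitInterval) : EReal :=
  if x then ENNReal.log (ENNReal.ofReal (p : ℝ)) else ENNReal.log (ENNReal.ofReal (1 - (p : ℝ)))

/-- The conditional log-likelihood `L₁(x; z, π)` given the labels. -/
def L1 {Q n : ℕ} (x : Fin n → Fin n → Bool) (z : Fin n → Fin Q) (π : Connectivity Q) : EReal :=
  ∑ p ∈ (Finset.univ : Finset (Fin n)).offDiag, edgeLogLik (x p.1 p.2) (π (z p.1) (z p.2))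

/-- `P_α(Z_[n] = z)`. -/
def labelProb {Q n : ℕ} (α : Fin Q → ℝ) (z : Fin n → Fin Q) : ENNReal :=
  ∏ i, ENNReal.ofReal (α (z i))

/-- The likelihood `∑_z exp(L₁(x; z, π)) P_α(Z_[n] = z)`. -/
def lik {Q n : ℕ} (x : Fin n → Fin n → Bool) (α : Fin Q → ℝ) (π : Connectivity Q) : ENNReal :=
  ∑ z : Fin n → Fin Q, EReal.exp (L1 x z π) * labelProb α z

/-- The log-likelihood `L₂(x; α, π)`. -/
def L2 {Q n : ℕ} (x : Fin n → Fin n → Bool) (α : Fin Q → ℝ) (π : Connectivity Q) : EReal :=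
  ENNReal.log (lik x α π)

/-- The conditional distribution `P_{α,π}(Z_[n] = · ∣ X_[n] = x)` of the labels given the graph.
If `x` has likelihood zero, this is the zero measure. -/
def posterior {Q n : ℕ} (x : Fin n → Fin n → Bool) (α : Fin Q → ℝ) (π : Connectivity Q) :
    Measure (Fin n → Fin Q) :=
  ∑ z : Fin n → Fin Q, (EReal.exp (L1 x z π) * labelProb α z / lik x α π) • Measure.dirac z

/-- The set `S_n` of variational parameters `τ`: each `τ i` is a probability vector. -/
def varParams (Q n : ℕ) : Set (Fin n → Fin Q → ℝ) :=
  {τ | ∀ i, τ i ∈ stdSimplex ℝ (Fin Q)}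

/-- The product distribution `D_τ = ⊗ᵢ M(1, τ_{i,1}, …, τ_{i,Q})` on label vectors. -/
def productLaw {Q n : ℕ} (τ : Fin n → Fin Q → ℝ) : Measure (Fin n → Fin Q) :=
  Measure.pi fun i => ∑ q : Fin Q, ENNReal.ofReal (τ i q) • Measure.dirac q

/-- The variational log-likelihood `J(x; τ, α, π) = L₂(x; α, π) - K(D_τ, P_{α,π}(· ∣ x))`.
It is `-∞` if `x` has likelihood zero under `(α, π)`. -/
def varLogLik {Q n : ℕ} (x : Fin n → Fin n → Bool) (τ : Fin n → Fin Q → ℝ)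
    (α : Fin Q → ℝ) (π : Connectivity Q) : EReal :=
  L2 x α π - (InformationTheory.klDiv (productLaw τ) (posterior x α π) : EReal)

/-- `J_n(α, π) = J(x; τ̂, α, π) / (n (n - 1))`, where `τ̂ = τ̂(α, π)` maximizes `J(x; ·, α, π)` over
the compact set `S_n`; so `J(x; τ̂, α, π)` is the supremum over `S_n`. -/
def Jn {Q n : ℕ} (x : Fin n → Fin n → Bool) (α : Fin Q → ℝ) (π : Connectivity Q) : EReal :=
  (⨆ τ ∈ varParams Q n, varLogLik x τ α π) / (((n : ℝ) * ((n : ℝ) - 1) : ℝ) : EReal)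

/-- `θ ∈ argmax_{(α, π) ∈ Θ} J_n(α, π)` for the observed graph `x`. -/
def IsVariationalEstimate {Q n : ℕ} (Θ : Set (Param Q)) (x : Fin n → Fin n → Bool)
    (θ : Param Q) : Prop :=
  θ ∈ Θ ∧ IsMaxOn (fun θ' : Param Q => Jn x θ'.1 θ'.2) Θ θ

/-- A distance on `[0,1]^{Q × Q}` that is continuous for the usual topology (by compactness, it then
induces the usual topology). -/
structure IsDistance {Q : ℕ} (d : Connectivity Q → Connectivity Q → ℝ) : Prop where
  eq_zero_iff : ∀ x y, d x y = 0 ↔ x = y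
  symm : ∀ x y, d x y = d y x
  triangle : ∀ x y w, d x w ≤ d x y + d y w
  continuous : Continuous fun p : Connectivity Q × Connectivity Q => d p.1 p.2

end SBM

end

/-! The criterion is squeezed between two likelihoods. A product law concentrated at the true
labelling shows that at the true parameter the maximum over `τ` is at least the log of the joint
probability of labels and graph (`log_weight_le_varSup`). At any parameter it is at most `L2`, hence
at most the largest conditional log-likelihood over labellings (`varSup_le_of_edgeProd_le`). The
label probabilities cost only `n * log γ`, which is negligible at scale `n ^ 2`.

At scale `n ^ 2`, conditional log-likelihoods are compared through their means. Since `log 0`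
prevents uniform concentration, logarithms are truncated at `-1/ζ`: this raises the upper bound at a
competitor, changes nothing at the truth on graphs of positive probability, and still separates
distinct entries allowed by (A2) (`excess_pos`). Deviations reduce to edge counts between pairs of
vertex sets. There are `4 ^ n` pairs, each failing with probability `exp (-c * n ^ 2)`, so a union
bound suffices (`IsSBM.measure_edgeDev`, `tendsto_exp_neg_sq`).

Under (A1), the mean excess vanishes for an assignment of classes only if the two matrices agree up
to relabelling. Compactness gives a uniform gap (`exists_gap`), and pigeonhole turns it into a loss
of order `n ^ 2` for every labelling (`le_sum_excess`). Hence on typical graphs no parameter in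
`farSet` reaches the criterion of the truth (`exists_typical_varSup_lt`).

Finally, the estimator is constrained only when a maximizer over `Θ` exists. One exists on the
compact set given by (A2) and (A3), by upper semicontinuity. On typical graphs it satisfies (A1),
because `farSet` contains the violators, so it lies in `Θ`. -/

namespace SBM

/-! ### Real-valued form of the likelihoods -/

/-- The probability of the value `b` under the Bernoulli law of parameter `p`. -/
noncomputable def bern (p : ℝ) (b : Bool) : ℝ := if b then p else 1 - p

lemma bern_nonneg (p : unitInterval) (b : Bool) : 0 ≤ bern p b := by
  unfold bern
  split_ifs
  · exact p.2.1
  · linarith [p.2.2]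

lemma continuous_bern (b : Bool) : Continuous fun p : unitInterval => bern p b := by
  cases b
  · simp only [bern, Bool.false_eq_true, if_false]
    fun_prop
  · simp only [bern, if_true]
    fun_prop

/-- The conditional likelihood `exp (L₁(x; z, π))` as a real number. -/
noncomputable def edgeProd {Q n : ℕ} (x : Fin n → Fin n → Bool) (z : Fin n → Fin Q)
    (π : Connectivity Q) : ℝ :=
  ∏ p ∈ (Finset.univ : Finset (Fin n)).offDiag, bern (π (z p.1) (z p.2)) (x p.1 p.2)

/-- The joint probability of the labels `z` and the graph `x`. -/
noncomputable def weight {Q n : ℕ} (x : Fin n → Fin n → Bool) (z : Fin n → Fin Q)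
    (α : Fin Q → ℝ) (π : Connectivity Q) : ℝ :=
  (∏ i, α (z i)) * edgeProd x z π

lemma edgeProd_nonneg {Q n : ℕ} (x : Fin n → Fin n → Bool) (z : Fin n → Fin Q)
    (π : Connectivity Q) : 0 ≤ edgeProd x z π :=
  Finset.prod_nonneg fun _ _ => bern_nonneg _ _

lemma weight_nonneg {Q n : ℕ} (x : Fin n → Fin n → Bool) (z : Fin n → Fin Q)
    {α : Fin Q → ℝ} (hα : ∀ q, 0 ≤ α q) (π : Connectivity Q) : 0 ≤ weight x z α π :=
  mul_nonneg (Finset.prod_nonneg fun _ _ => hα _) (edgeProd_nonneg _ _ _)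

lemma exp_edgeLogLik (x : Bool) (p : unitInterval) :
    EReal.exp (edgeLogLik x p) = ENNReal.ofReal (bern p x) := by
  cases x <;> simp only [edgeLogLik, bern, ENNReal.exp_log, if_true, Bool.false_eq_true, if_false]

lemma exp_L1 {Q n : ℕ} (x : Fin n → Fin n → Bool) (z : Fin n → Fin Q) (π : Connectivity Q) :
    EReal.exp (L1 x z π) = ENNReal.ofReal (edgeProd x z π) := by
  have h : ∀ (s : Finset (Fin n × Fin n)) (f : Fin n × Fin n → EReal),
      EReal.exp (∑ p ∈ s, f p) = ∏ p ∈ s, EReal.exp (f p) := by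
    intro s f
    induction s using Finset.cons_induction with
    | empty => simp
    | cons a s ha ih => rw [Finset.sum_cons, Finset.prod_cons, EReal.exp_add, ih]
  rw [L1, h, edgeProd, ENNReal.ofReal_prod_of_nonneg fun _ _ => bern_nonneg _ _]
  exact Finset.prod_congr rfl fun p _ => exp_edgeLogLik _ _

lemma exp_L1_mul_labelProb {Q n : ℕ} (x : Fin n → Fin n → Bool) (z : Fin n → Fin Q)
    {α : Fin Q → ℝ} (hα : ∀ q, 0 ≤ α q) (π : Connectivity Q) :
    EReal.exp (L1 x z π) * labelProb α z = ENNReal.ofReal (weight x z α π) := by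
  rw [exp_L1, labelProb, weight, mul_comm (∏ i, α (z i)),
    ENNReal.ofReal_mul (edgeProd_nonneg _ _ _), ENNReal.ofReal_prod_of_nonneg fun _ _ => hα _]

lemma lik_eq {Q n : ℕ} (x : Fin n → Fin n → Bool) {α : Fin Q → ℝ} (hα : ∀ q, 0 ≤ α q)
    (π : Connectivity Q) :
    lik x α π = ENNReal.ofReal (∑ z : Fin n → Fin Q, weight x z α π) := by
  rw [lik, ENNReal.ofReal_sum_of_nonneg fun z _ => weight_nonneg x z hα π]
  exact Finset.sum_congr rfl fun z _ => exp_L1_mul_labelProb x z hα π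

/-! ### The variational criterion as a finite sum, and its bounds -/

/-- The Kullback–Leibler divergence on a finite space. -/
lemma klDiv_fintype {α : Type*} [Fintype α] [MeasurableSpace α] [MeasurableSingletonClass α]
    (μ ν : Measure α) [IsProbabilityMeasure μ] [IsProbabilityMeasure ν] (h : μ ≪ ν) :
    InformationTheory.klDiv μ ν ≠ ⊤ ∧ (InformationTheory.klDiv μ ν).toReal =
      ∑ a, μ.real {a} * Real.log (μ.real {a} / ν.real {a}) := by
  have hint : Integrable (llr μ ν) μ := Integrable.of_finite
  refine ⟨InformationTheory.klDiv_ne_top h hint, ?_⟩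
  rw [InformationTheory.toReal_klDiv_of_measure_eq h (by simp), integral_fintype hint]
  refine Finset.sum_congr rfl fun a _ => ?_
  rw [smul_eq_mul]
  by_cases ha : ν {a} = 0
  · have : μ {a} = 0 := h ha
    simp [Measure.real, this]
  have key : μ {a} = μ.rnDeriv ν a * ν {a} := by
    conv_lhs => rw [← Measure.withDensity_rnDeriv_eq μ ν h]
    rw [withDensity_apply _ (measurableSet_singleton a), lintegral_singleton]
  have hν : ν.real {a} ≠ 0 := by
    simp [Measure.real, ENNReal.toReal_eq_zero_iff, ha]
  rw [llr_def]
  suffices h' : (μ.rnDeriv ν a).toReal = μ.real {a} / ν.real {a} by rw [← h']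
  rw [eq_div_iff hν]
  simp only [Measure.real, key, ENNReal.toReal_mul]

lemma productLaw_prob {Q n : ℕ} {τ : Fin n → Fin Q → ℝ} (hτ : τ ∈ varParams Q n) (i : Fin n) :
    IsProbabilityMeasure (∑ q : Fin Q, ENNReal.ofReal (τ i q) • Measure.dirac q) := by
  constructor
  simp only [Measure.coe_finsetSum, Finset.sum_apply, Measure.smul_apply, measure_univ,
    smul_eq_mul, mul_one]
  rw [← ENNReal.ofReal_sum_of_nonneg fun q _ => (hτ i).1 q, (hτ i).2, ENNReal.ofReal_one]

lemma isProbabilityMeasure_productLaw {Q n : ℕ} {τ : Fin n → Fin Q → ℝ}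
    (hτ : τ ∈ varParams Q n) : IsProbabilityMeasure (productLaw τ) := by
  have := productLaw_prob hτ
  unfold productLaw
  infer_instance

lemma productLaw_real_singleton {Q n : ℕ} {τ : Fin n → Fin Q → ℝ}
    (hτ : τ ∈ varParams Q n) (z : Fin n → Fin Q) :
    (productLaw τ).real {z} = ∏ i, τ i (z i) := by
  have := productLaw_prob hτ
  rw [productLaw, Measure.real, Measure.pi_singleton, ENNReal.toReal_prod]
  refine Finset.prod_congr rfl fun i _ => ?_
  simp only [Measure.coe_finsetSum, Finset.sum_apply, Measure.smul_apply, smul_eq_mul]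
  rw [Finset.sum_eq_single (z i)]
  · simp [ENNReal.toReal_ofReal ((hτ i).1 (z i))]
  · intro q _ hq
    simp [hq]
  · simp

lemma sum_prod_eq_one {Q n : ℕ} {τ : Fin n → Fin Q → ℝ} (hτ : τ ∈ varParams Q n) :
    ∑ z : Fin n → Fin Q, ∏ i, τ i (z i) = 1 := by
  rw [← Fintype.prod_sum]
  exact Finset.prod_eq_one fun i _ => (hτ i).2

lemma posterior_singleton {Q n : ℕ} (x : Fin n → Fin n → Bool) {α : Fin Q → ℝ}
    (hα : ∀ q, 0 ≤ α q) (π : Connectivity Q) (z : Fin n → Fin Q) :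
    posterior x α π {z} = ENNReal.ofReal (weight x z α π) / lik x α π := by
  rw [posterior]
  simp only [Measure.coe_finsetSum, Finset.sum_apply, Measure.smul_apply, smul_eq_mul]
  rw [Finset.sum_eq_single z]
  · simp [exp_L1_mul_labelProb x z hα π]
  · intro q _ hq
    simp [hq]
  · simp

lemma isProbabilityMeasure_posterior {Q n : ℕ} (x : Fin n → Fin n → Bool) {α : Fin Q → ℝ}
    (hα : ∀ q, 0 ≤ α q) (π : Connectivity Q) (h0 : lik x α π ≠ 0) :
    IsProbabilityMeasure (posterior x α π) := by
  have hl : lik x α π ≠ ⊤ := by rw [lik_eq x hα]; exact ENNReal.ofReal_ne_top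
  constructor
  rw [posterior]
  simp only [Measure.coe_finsetSum, Finset.sum_apply, Measure.smul_apply, smul_eq_mul,
    measure_univ, mul_one, div_eq_mul_inv, ← Finset.sum_mul]
  exact ENNReal.mul_inv_cancel h0 hl

/-- If `D_τ` charges only label vectors of positive posterior probability, the variational
log-likelihood is `∑_z D_τ(z) (log w(z) - log D_τ(z))`. -/
lemma varLogLik_eq_sum {Q n : ℕ} (x : Fin n → Fin n → Bool) {τ : Fin n → Fin Q → ℝ}
    (hτ : τ ∈ varParams Q n) {α : Fin Q → ℝ} (hα : ∀ q, 0 ≤ α q) (π : Connectivity Q)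
    (hac : ∀ z, weight x z α π = 0 → ∏ i, τ i (z i) = 0) :
    varLogLik x τ α π = ((∑ z : Fin n → Fin Q, (∏ i, τ i (z i)) *
      (Real.log (weight x z α π) - Real.log (∏ i, τ i (z i))) : ℝ) : EReal) := by
  have hP := isProbabilityMeasure_productLaw hτ
  have hsum := sum_prod_eq_one hτ
  set W := ∑ z : Fin n → Fin Q, weight x z α π with hW
  have hW0 : 0 ≤ W := Finset.sum_nonneg fun z _ => weight_nonneg x z hα π
  have hWpos : 0 < W := by
    refine lt_of_le_of_ne hW0 fun h => ?_
    have hz := (Finset.sum_eq_zero_iff_of_nonneg fun z _ => weight_nonneg x z hα π).1 h.symm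
    have : ∑ z : Fin n → Fin Q, ∏ i, τ i (z i) = 0 :=
      Finset.sum_eq_zero fun z hz' => hac z (hz z hz')
    linarith
  have hlik : lik x α π = ENNReal.ofReal W := lik_eq x hα π
  have hl0 : lik x α π ≠ 0 := by
    rw [hlik]; simpa using hWpos
  have hP' := isProbabilityMeasure_posterior x hα π hl0
  have hpost : ∀ z, (posterior x α π).real {z} = weight x z α π / W := by
    intro z
    rw [Measure.real, posterior_singleton x hα, hlik, ENNReal.toReal_div,
      ENNReal.toReal_ofReal (weight_nonneg x z hα π), ENNReal.toReal_ofReal hW0]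
  have habs : productLaw τ ≪ posterior x α π := by
    refine Measure.AbsolutelyContinuous.mk fun s _ hs => ?_
    rw [← Set.biUnion_of_singleton s]
    refine (measure_biUnion_null_iff s.to_countable).2 fun z hz => ?_
    have h1 : posterior x α π {z} = 0 := measure_mono_null (by simpa using hz) hs
    have h2 : weight x z α π / W = 0 := by rw [← hpost, Measure.real, h1]; simp
    have h3 : weight x z α π = 0 := by
      rcases div_eq_zero_iff.1 h2 with h | h
      · exact h
      · exact absurd h hWpos.ne'
    have h4 := productLaw_real_singleton hτ z
    rw [hac z h3] at h4
    exact (measureReal_eq_zero_iff).1 h4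
  obtain ⟨hne, hkl⟩ := klDiv_fintype _ _ habs
  rw [varLogLik, L2, hlik, ENNReal.log_ofReal_of_pos hWpos]
  rw [← EReal.coe_toReal (x := ((InformationTheory.klDiv (productLaw τ) (posterior x α π) :
    ENNReal) : EReal)) (by simpa using hne) (by simp)]
  rw [EReal.toReal_coe_ennreal, hkl, ← EReal.coe_sub]
  congr 1
  have : Real.log W = ∑ z : Fin n → Fin Q, (∏ i, τ i (z i)) * Real.log W := by
    rw [← Finset.sum_mul, hsum, one_mul]
  rw [this, ← Finset.sum_sub_distrib]
  refine Finset.sum_congr rfl fun z _ => ?_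
  rw [productLaw_real_singleton hτ, hpost]
  by_cases h0 : ∏ i, τ i (z i) = 0
  · simp [h0]
  have hw : weight x z α π ≠ 0 := fun h => h0 (hac z h)
  rw [Real.log_div h0 (div_ne_zero hw hWpos.ne'), Real.log_div hw hWpos.ne']
  ring

lemma varLogLik_eq_bot {Q n : ℕ} (x : Fin n → Fin n → Bool) {τ : Fin n → Fin Q → ℝ}
    (hτ : τ ∈ varParams Q n) {α : Fin Q → ℝ} (hα : ∀ q, 0 ≤ α q) (π : Connectivity Q)
    {z : Fin n → Fin Q} (hz : weight x z α π = 0) (hz' : ∏ i, τ i (z i) ≠ 0) :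
    varLogLik x τ α π = ⊥ := by
  have hna : ¬ productLaw τ ≪ posterior x α π := by
    intro h
    have h1 : posterior x α π {z} = 0 := by
      rw [posterior_singleton x hα, hz]; simp
    refine hz' ?_
    rw [← productLaw_real_singleton hτ, Measure.real, h h1]
    simp
  rw [varLogLik, InformationTheory.klDiv_of_not_ac hna]
  simp

/-- The unnormalized criterion `max_τ J(x; τ, α, π)`. -/
noncomputable def varSup {Q n : ℕ} (x : Fin n → Fin n → Bool) (θ : Param Q) : EReal :=
  ⨆ τ ∈ varParams Q n, varLogLik x τ θ.1 θ.2

lemma varSup_le_L2 {Q n : ℕ} (x : Fin n → Fin n → Bool) (θ : Param Q) :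
    varSup x θ ≤ L2 x θ.1 θ.2 := by
  refine iSup₂_le fun τ _ => ?_
  rw [varLogLik]
  exact EReal.sub_le_of_le_add' (le_add_of_nonneg_left (by positivity))

/-- Take for `D_τ` the point mass at `z`: its entropy is zero, so only the log-weight of `z`
remains. -/
lemma log_weight_le_varSup {Q n : ℕ} (x : Fin n → Fin n → Bool) (z : Fin n → Fin Q) (θ : Param Q)
    (hα : ∀ q, 0 ≤ θ.1 q) (hz : 0 < weight x z θ.1 θ.2) :
    (Real.log (weight x z θ.1 θ.2) : EReal) ≤ varSup x θ := by
  let τ : Fin n → Fin Q → ℝ := fun i q => if q = z i then 1 else 0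
  have hτ : τ ∈ varParams Q n := by
    refine fun i => ⟨fun q => ?_, by simp [τ]⟩
    simp only [τ]; split_ifs <;> norm_num
  have hprod : ∀ z', ∏ i, τ i (z' i) = if z' = z then 1 else 0 := by
    intro z'
    split_ifs with h
    · simp [τ, h]
    · obtain ⟨i, hi⟩ := Function.ne_iff.1 h
      exact Finset.prod_eq_zero (Finset.mem_univ i) (by simp [τ, hi])
  refine le_trans ?_ (le_iSup₂ (f := fun τ _ => varLogLik x τ θ.1 θ.2) τ hτ)
  rw [varLogLik_eq_sum x hτ hα]
  · simp [hprod]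
  · intro z' h
    rw [hprod, if_neg]
    rintro rfl
    exact hz.ne' h

/-- If the weights under `θ` are at most `e^η` times those under `θ₀`, the criterion at `θ` exceeds
the one at `θ₀` by at most `η`. -/
lemma varSup_le_add {Q n : ℕ} (x : Fin n → Fin n → Bool) (θ θ₀ : Param Q) (η : ℝ)
    (hα : ∀ q, 0 ≤ θ.1 q) (hα₀ : ∀ q, 0 ≤ θ₀.1 q)
    (h : ∀ z, weight x z θ.1 θ.2 ≤ Real.exp η * weight x z θ₀.1 θ₀.2) :
    varSup x θ ≤ varSup x θ₀ + η := by
  refine iSup₂_le fun τ hτ => ?_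
  by_cases hac : ∀ z, weight x z θ.1 θ.2 = 0 → ∏ i, τ i (z i) = 0
  -- The domination of weights carries the support condition from `θ` to `θ₀`, so both criteria are
  -- finite sums comparable term by term. In the other case the left side is `⊥`.
  · have hac₀ : ∀ z, weight x z θ₀.1 θ₀.2 = 0 → ∏ i, τ i (z i) = 0 := by
      intro z hz
      refine hac z (le_antisymm ?_ (weight_nonneg x z hα _))
      simpa [hz] using h z
    refine le_trans ?_ (add_le_add_left
      (le_iSup₂ (f := fun τ _ => varLogLik x τ θ₀.1 θ₀.2) τ hτ) _)
    rw [varLogLik_eq_sum x hτ hα _ hac, varLogLik_eq_sum x hτ hα₀ _ hac₀, ← EReal.coe_add,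
      EReal.coe_le_coe_iff]
    have hsum := sum_prod_eq_one hτ
    have : η = ∑ z : Fin n → Fin Q, (∏ i, τ i (z i)) * η := by
      rw [← Finset.sum_mul, hsum, one_mul]
    rw [this, ← Finset.sum_add_distrib]
    refine Finset.sum_le_sum fun z _ => ?_
    have hD : 0 ≤ ∏ i, τ i (z i) := Finset.prod_nonneg fun i _ => (hτ i).1 _
    by_cases h0 : ∏ i, τ i (z i) = 0
    · simp [h0]
    have hw : 0 < weight x z θ.1 θ.2 :=
      lt_of_le_of_ne (weight_nonneg x z hα _) fun hh => h0 (hac z hh.symm)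
    have hw₀ : weight x z θ₀.1 θ₀.2 ≠ 0 := fun hh => h0 (hac₀ z hh)
    have := Real.log_le_log hw (h z)
    rw [Real.log_mul (Real.exp_pos _).ne' hw₀, Real.log_exp] at this
    rw [← mul_add]
    exact mul_le_mul_of_nonneg_left (by linarith) hD
  · push Not at hac
    obtain ⟨z, hz, hz'⟩ := hac
    rw [varLogLik_eq_bot x hτ hα _ hz hz']
    exact bot_le

/-! ### Compactness and existence of maximizers -/

lemma A2.eq_zero_or_one_or_mem_Icc {Q : ℕ} {ζ : ℝ} {π : Connectivity Q} (h : A2 ζ π)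
    (q l : Fin Q) : (π q l : ℝ) = 0 ∨ (π q l : ℝ) = 1 ∨ (π q l : ℝ) ∈ Set.Icc ζ (1 - ζ) := by
  rcases eq_or_lt_of_le (π q l).2.1 with h0 | h0
  · exact Or.inl h0.symm
  rcases eq_or_lt_of_le (π q l).2.2 with h1 | h1
  · exact Or.inr (Or.inl h1)
  · exact Or.inr (Or.inr (h q l ⟨h0, h1⟩))

lemma A2.bern_eq_zero_or_le {Q : ℕ} {ζ : ℝ} {π : Connectivity Q} (h : A2 ζ π)
    (q l : Fin Q) (b : Bool) : bern (π q l) b = 0 ∨ min ζ 1 ≤ bern (π q l) b := by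
  rcases h.eq_zero_or_one_or_mem_Icc q l with h | h | h
  · cases b <;> simp [bern, h]
  · cases b <;> simp [bern, h]
  · refine Or.inr ((min_le_left _ _).trans ?_)
    cases b
    · simpa [bern] using by linarith [h.2]
    · simpa [bern] using h.1

lemma isClosed_A2 (Q : ℕ) (ζ : ℝ) : IsClosed {π : Connectivity Q | A2 ζ π} := by
  have : {π : Connectivity Q | A2 ζ π} = ⋂ q, ⋂ l, {π : Connectivity Q |
      (π q l : ℝ) = 0 ∨ (π q l : ℝ) = 1 ∨ (π q l : ℝ) ∈ Set.Icc ζ (1 - ζ)} := by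
    ext π
    simp only [Set.mem_ofPred_eq, Set.mem_iInter]
    refine ⟨fun h q l => h.eq_zero_or_one_or_mem_Icc q l, fun h q l hI => ?_⟩
    rcases h q l with h | h | h
    · exact absurd h hI.1.ne'
    · exact absurd h hI.2.ne
    · exact h
  rw [this]
  refine isClosed_iInter fun q => isClosed_iInter fun l => ?_
  have hc : Continuous fun π : Connectivity Q => (π q l : ℝ) := by fun_prop
  exact (isClosed_eq hc continuous_const).union
    ((isClosed_eq hc continuous_const).union (isClosed_Icc.preimage hc))

lemma isCompact_paramA23 (Q : ℕ) (ζ γ : ℝ) : IsCompact (paramA23 Q ζ γ) := by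
  have h1 : IsCompact (stdSimplex ℝ (Fin Q) ×ˢ (Set.univ : Set (Connectivity Q))) :=
    (isCompact_stdSimplex ℝ (Fin Q)).prod isCompact_univ
  have h2 : IsClosed {θ : Param Q | A2 ζ θ.2 ∧ A3 γ θ.1} := by
    refine ((isClosed_A2 Q ζ).preimage continuous_snd).inter ?_
    have : {θ : Param Q | A3 γ θ.1} = ⋂ q, {θ : Param Q | θ.1 q ∈ Set.Icc γ (1 - γ)} := by
      ext θ; simp [A3]
    change IsClosed {θ : Param Q | A3 γ θ.1}
    rw [this]
    exact isClosed_iInter fun q => isClosed_Icc.preimage (by fun_prop)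
  convert h1.inter_right h2 using 1
  ext θ
  simp [paramA23]

lemma continuous_weight {Q n : ℕ} (x : Fin n → Fin n → Bool) (z : Fin n → Fin Q) :
    Continuous fun θ : Param Q => weight x z θ.1 θ.2 := by
  unfold weight edgeProd
  refine (continuous_finsetProd _ fun i _ => by fun_prop).mul
    (continuous_finsetProd _ fun p _ => ?_)
  exact (continuous_bern _).comp (by fun_prop : Continuous fun θ : Param Q => θ.2 (z p.1) (z p.2))

/-- Positive weights are handled by continuity. If a weight vanishes at `θ₀`, some edge factor does;
under (A2) that factor is either zero or at least `min ζ 1`, so by continuity it stays exactly zero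
nearby. This is what makes the criterion upper semicontinuous despite `log 0`. -/
lemma eventually_weight_le {Q n : ℕ} {ζ γ : ℝ} (hζ : 0 < ζ) (hγ : 0 < γ)
    (x : Fin n → Fin n → Bool) {θ₀ : Param Q} (hθ₀ : θ₀ ∈ paramA23 Q ζ γ) {η : ℝ} (hη : 0 < η) :
    ∀ᶠ θ in nhdsWithin θ₀ (paramA23 Q ζ γ),
      ∀ z, weight x z θ.1 θ.2 ≤ Real.exp η * weight x z θ₀.1 θ₀.2 := by
  refine Filter.eventually_all.2 fun z => ?_
  rcases (weight_nonneg x z hθ₀.1.1 θ₀.2).eq_or_lt with h0 | h0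
  · have hα : ∏ i, θ₀.1 (z i) ≠ 0 :=
      (Finset.prod_pos fun i _ => hγ.trans_le (hθ₀.2.2 (z i)).1).ne'
    obtain ⟨p, hp, hp0⟩ := Finset.prod_eq_zero_iff.1
      ((mul_eq_zero.1 h0.symm).resolve_left hα)
    have hc : Continuous fun θ : Param Q => bern (θ.2 (z p.1) (z p.2)) (x p.1 p.2) :=
      (continuous_bern _).comp
        (by fun_prop : Continuous fun θ : Param Q => θ.2 (z p.1) (z p.2))
    have hev := (hc.tendsto θ₀).eventually (gt_mem_nhds (show _ < min ζ 1 by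
      rw [hp0]; exact lt_min hζ one_pos))
    filter_upwards [nhdsWithin_le_nhds hev, self_mem_nhdsWithin] with θ hθ hθK
    have h1 : bern (θ.2 (z p.1) (z p.2)) (x p.1 p.2) = 0 :=
      (hθK.2.1.bern_eq_zero_or_le _ _ _).resolve_right (not_le.2 hθ)
    have h2 : weight x z θ.1 θ.2 = 0 := by
      rw [weight, edgeProd, Finset.prod_eq_zero hp h1, mul_zero]
    rw [h2, ← h0, mul_zero]
  · have hlt : weight x z θ₀.1 θ₀.2 < Real.exp η * weight x z θ₀.1 θ₀.2 :=
      lt_mul_of_one_lt_left h0 (Real.one_lt_exp_iff.2 hη)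
    filter_upwards [nhdsWithin_le_nhds
      (((continuous_weight x z).tendsto θ₀).eventually (gt_mem_nhds hlt))] with θ hθ
    exact hθ.le

lemma sum_weight_le {Q n : ℕ} (x : Fin n → Fin n → Bool) {α : Fin Q → ℝ}
    (hα : α ∈ stdSimplex ℝ (Fin Q)) (π : Connectivity Q) {U : ℝ}
    (hU : ∀ z, edgeProd x z π ≤ U) :
    ∑ z : Fin n → Fin Q, weight x z α π ≤ U := by
  have hsum : ∑ z : Fin n → Fin Q, ∏ i, α (z i) = 1 := sum_prod_eq_one (τ := fun _ => α) fun _ => hα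
  calc ∑ z : Fin n → Fin Q, weight x z α π
      ≤ ∑ z : Fin n → Fin Q, (∏ i, α (z i)) * U := Finset.sum_le_sum fun z _ =>
        mul_le_mul_of_nonneg_left (hU z) (Finset.prod_nonneg fun i _ => hα.1 _)
    _ = U := by rw [← Finset.sum_mul, hsum, one_mul]

/-- If `exp (L₁(x; z, π)) ≤ e^U` for all labels `z`, then the criterion is at most `U`. -/
lemma varSup_le_of_edgeProd_le {Q n : ℕ} (x : Fin n → Fin n → Bool) {θ : Param Q}
    (hα : θ.1 ∈ stdSimplex ℝ (Fin Q)) {U : ℝ} (hU : ∀ z, edgeProd x z θ.2 ≤ Real.exp U) :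
    varSup x θ ≤ U := by
  refine (varSup_le_L2 x θ).trans ?_
  rw [L2, lik_eq x hα.1, ← EReal.log_exp (U : EReal), EReal.exp_coe]
  exact ENNReal.log_le_log (ENNReal.ofReal_le_ofReal (sum_weight_le x hα θ.2 hU))

lemma edgeProd_le_one {Q n : ℕ} (x : Fin n → Fin n → Bool) (z : Fin n → Fin Q)
    (π : Connectivity Q) : edgeProd x z π ≤ 1 := by
  refine Finset.prod_le_one (fun _ _ => bern_nonneg _ _) fun p _ => ?_
  cases x p.1 p.2
  · simpa [bern] using (π (z p.1) (z p.2)).2.1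
  · simpa [bern] using (π (z p.1) (z p.2)).2.2

lemma upperSemicontinuousOn_varSup {Q n : ℕ} {ζ γ : ℝ} (hζ : 0 < ζ) (hγ : 0 < γ)
    (x : Fin n → Fin n → Bool) :
    UpperSemicontinuousOn (varSup x) (paramA23 Q ζ γ) := by
  intro θ₀ hθ₀ y hy
  -- An additive margin `η` below `y` exists because the criterion is at most `0`, hence never `⊤`.
  obtain ⟨η, hη, hlt⟩ : ∃ η : ℝ, 0 < η ∧ varSup x θ₀ + η < y := by
    rcases eq_or_ne (varSup x θ₀) ⊥ with hb | hb
    · exact ⟨1, one_pos, by rw [hb] at hy ⊢; simpa using hy⟩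
    have ht : varSup x θ₀ ≠ ⊤ := by
      refine ne_top_of_le_ne_top (EReal.coe_ne_top 0)
        (varSup_le_of_edgeProd_le x hθ₀.1 fun z => ?_)
      simpa using edgeProd_le_one x z θ₀.2
    obtain ⟨r, hr⟩ : ∃ r : ℝ, varSup x θ₀ = r := ⟨_, (EReal.coe_toReal ht hb).symm⟩
    obtain ⟨s, hs1, hs2⟩ := EReal.lt_iff_exists_real_btwn.1 hy
    rw [hr] at hs1 ⊢
    refine ⟨s - r, sub_pos.2 (EReal.coe_lt_coe_iff.1 hs1), ?_⟩
    rw [← EReal.coe_add, add_sub_cancel]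
    exact hs2
  filter_upwards [eventually_weight_le hζ hγ x hθ₀ hη, self_mem_nhdsWithin] with θ hθ hθK
  exact (varSup_le_add x θ θ₀ η hθK.1.1 hθ₀.1.1 hθ).trans_lt hlt

lemma exists_isMaxOn_varSup {Q n : ℕ} {ζ γ : ℝ} (hζ : 0 < ζ) (hγ : 0 < γ)
    (x : Fin n → Fin n → Bool) (hne : (paramA23 Q ζ γ).Nonempty) :
    ∃ θ ∈ paramA23 Q ζ γ, IsMaxOn (varSup x) (paramA23 Q ζ γ) θ :=
  (upperSemicontinuousOn_varSup hζ hγ x).exists_isMaxOn hne (isCompact_paramA23 Q ζ γ)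

/-- For `n ≥ 2` the normalization `n * (n - 1)` is positive; for smaller `n` it is zero. -/
lemma Jn_le_iff {Q n : ℕ} (hn : 2 ≤ n) (x : Fin n → Fin n → Bool) (θ θ' : Param Q) :
    Jn x θ.1 θ.2 ≤ Jn x θ'.1 θ'.2 ↔ varSup x θ ≤ varSup x θ' := by
  have h2 : (2 : ℝ) ≤ n := by exact_mod_cast hn
  have hpos : (0 : ℝ) < (n : ℝ) * ((n : ℝ) - 1) := mul_pos (by linarith) (by linarith)
  exact (EReal.strictMono_div_right_of_pos (EReal.coe_pos.2 hpos) (EReal.coe_ne_top _)).le_iff_le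

/-! ### Truncated logarithm and excess cross-entropy -/

/-- The logarithm truncated from below at `-1 / ζ`. -/
noncomputable def truncLog (ζ p : ℝ) : ℝ := Real.log (max p (Real.exp (-(1 / ζ))))

/-- The expected truncated log-likelihood at `b` of a Bernoulli variable of parameter `a`. -/
noncomputable def crossEnt (ζ a b : ℝ) : ℝ := a * truncLog ζ b + (1 - a) * truncLog ζ (1 - b)

/-- The excess of the truncated cross-entropy over the entropy. -/
noncomputable def excess (ζ a b : ℝ) : ℝ := crossEnt ζ a a - crossEnt ζ a b

lemma max_exp_pos (ζ p : ℝ) : 0 < max p (Real.exp (-(1 / ζ))) :=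
  lt_max_of_lt_right (Real.exp_pos _)

lemma continuous_truncLog (ζ : ℝ) : Continuous (truncLog ζ) :=
  (continuous_id.max continuous_const).log fun p => (max_exp_pos ζ p).ne'

lemma le_exp_truncLog (ζ p : ℝ) : p ≤ Real.exp (truncLog ζ p) := by
  rw [truncLog, Real.exp_log (max_exp_pos ζ p)]
  exact le_max_left _ _

lemma truncLog_zero (ζ : ℝ) : truncLog ζ 0 = -(1 / ζ) := by
  rw [truncLog, max_eq_right (Real.exp_pos _).le, Real.log_exp]

lemma exp_neg_inv_lt_one {ζ : ℝ} (hζ : 0 < ζ) : Real.exp (-(1 / ζ)) < 1 :=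
  Real.exp_lt_one_iff.2 (neg_neg_of_pos (by positivity))

lemma truncLog_one {ζ : ℝ} (hζ : 0 < ζ) : truncLog ζ 1 = 0 := by
  rw [truncLog, max_eq_left (exp_neg_inv_lt_one hζ).le, Real.log_one]

/-- The truncation level `exp (-1/ζ)` lies below `ζ`, since `exp t ≥ t + 1` at `t = 1/ζ`. -/
lemma truncLog_of_le {ζ p : ℝ} (hζ : 0 < ζ) (hp : ζ ≤ p) : truncLog ζ p = Real.log p := by
  rw [truncLog, max_eq_left]
  refine le_trans ?_ hp
  rw [Real.exp_neg, inv_le_comm₀ (Real.exp_pos _) hζ, ← one_div]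
  linarith [Real.add_one_le_exp (1 / ζ)]

lemma truncLog_neg {ζ p : ℝ} (hζ : 0 < ζ) (hp : p < 1) : truncLog ζ p < 0 :=
  Real.log_neg (max_exp_pos ζ p) (max_lt hp (exp_neg_inv_lt_one hζ))

lemma truncLog_nonpos {ζ p : ℝ} (hζ : 0 < ζ) (hp : p ≤ 1) : truncLog ζ p ≤ 0 :=
  Real.log_nonpos (max_exp_pos ζ p).le (max_le hp (exp_neg_inv_lt_one hζ).le)

lemma neg_inv_le_truncLog (ζ p : ℝ) : -(1 / ζ) ≤ truncLog ζ p := by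
  rw [truncLog, Real.le_log_iff_exp_le (max_exp_pos ζ p)]
  exact le_max_right _ _

lemma continuous_excess (ζ a : ℝ) : Continuous (excess ζ a) := by
  have := continuous_truncLog ζ
  unfold excess crossEnt
  fun_prop

lemma neg_one_lt_crossEnt_self {ζ a : ℝ} (hζ : 0 < ζ) (ha : a ∈ Set.Icc ζ (1 - ζ)) :
    -1 < crossEnt ζ a a := by
  have h := Real.binEntropy_le_log_two (p := a)
  rw [Real.binEntropy, Real.log_inv, Real.log_inv] at h
  rw [crossEnt, truncLog_of_le hζ ha.1, truncLog_of_le hζ (by linarith [ha.2])]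
  linarith [Real.log_two_lt_d9]

/-- For two interior values this is the strict Gibbs inequality. If `a` is interior and `b` is `0`
or `1`, the truncated logarithm costs at least `ζ * (1/ζ) = 1`, more than the entropy, which is at
most `log 2`. If `a` is `0` or `1`, its own term vanishes and the competing one is negative. -/
lemma excess_pos {ζ a b : ℝ} (hζ : 0 < ζ) (ha : a = 0 ∨ a = 1 ∨ a ∈ Set.Icc ζ (1 - ζ))
    (hb : b = 0 ∨ b = 1 ∨ b ∈ Set.Icc ζ (1 - ζ)) (hab : a ≠ b) : 0 < excess ζ a b := by
  have hb01 : 0 ≤ b ∧ b ≤ 1 := by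
    rcases hb with rfl | rfl | hb
    · norm_num
    · norm_num
    · exact ⟨hζ.le.trans hb.1, by linarith [hb.2]⟩
  have h0 := truncLog_zero ζ
  have h1 := truncLog_one hζ
  rw [excess, sub_pos]
  rcases ha with rfl | rfl | ha
  · have : truncLog ζ (1 - b) < 0 :=
      truncLog_neg hζ (by linarith [lt_of_le_of_ne hb01.1 hab])
    simpa [crossEnt, h1] using this
  · have : truncLog ζ b < 0 := truncLog_neg hζ (lt_of_le_of_ne hb01.2 hab.symm)
    simpa [crossEnt, h1] using this
  · have hent := neg_one_lt_crossEnt_self hζ ha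
    rcases hb with rfl | rfl | hb
    · refine lt_of_le_of_lt ?_ hent
      have : 1 ≤ a * (1 / ζ) := by rw [mul_one_div, le_div_iff₀ hζ]; linarith [ha.1]
      simp only [crossEnt, h0, sub_zero, h1]
      linarith
    · refine lt_of_le_of_lt ?_ hent
      have : 1 ≤ (1 - a) * (1 / ζ) := by rw [mul_one_div, le_div_iff₀ hζ]; linarith [ha.2]
      simp only [crossEnt, h0, sub_self, h1]
      linarith
    · have ha0 : 0 < a := hζ.trans_le ha.1
      have ha1 : 0 < 1 - a := by linarith [ha.2]
      have hb0 : 0 < b := hζ.trans_le hb.1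
      have hb1 : 0 < 1 - b := by linarith [hb.2]
      simp only [crossEnt, truncLog_of_le hζ ha.1, truncLog_of_le hζ hb.1,
        truncLog_of_le hζ (by linarith [ha.2] : ζ ≤ 1 - a),
        truncLog_of_le hζ (by linarith [hb.2] : ζ ≤ 1 - b)]
      have e1 : a * (Real.log b - Real.log a) < b - a := by
        rw [← Real.log_div hb0.ne' ha0.ne']
        have := Real.log_lt_sub_one_of_pos (div_pos hb0 ha0)
          (fun h => hab ((div_eq_one_iff_eq ha0.ne').1 h).symm)
        calc a * Real.log (b / a) < a * (b / a - 1) := mul_lt_mul_of_pos_left this ha0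
          _ = b - a := by field_simp
      have e2 : (1 - a) * (Real.log (1 - b) - Real.log (1 - a)) ≤ a - b := by
        rw [← Real.log_div hb1.ne' ha1.ne']
        have := Real.log_le_sub_one_of_pos (div_pos hb1 ha1)
        calc (1 - a) * Real.log ((1 - b) / (1 - a)) ≤ (1 - a) * ((1 - b) / (1 - a) - 1) :=
              mul_le_mul_of_nonneg_left this ha1.le
          _ = a - b := by field_simp; ring
      linarith

lemma excess_nonneg {ζ a b : ℝ} (hζ : 0 < ζ) (ha : a = 0 ∨ a = 1 ∨ a ∈ Set.Icc ζ (1 - ζ))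
    (hb : b = 0 ∨ b = 1 ∨ b ∈ Set.Icc ζ (1 - ζ)) : 0 ≤ excess ζ a b := by
  by_cases hab : a = b
  · simp [excess, hab]
  · exact (excess_pos hζ ha hb hab).le

/-! ### Identifiability and the quadratic gap -/

/-- Under (A1), a relation `π*_{r,s} = π_{f(r),f(s)}` forces `f` to be a permutation. -/
lemma exists_relabel_eq {Q : ℕ} {π πs : Connectivity Q} (hs : A1 πs) (f : Fin Q → Fin Q)
    (h : ∀ r s, πs r s = π (f r) (f s)) : ∃ σ, relabel σ π = πs := by
  have hf : Function.Injective f := by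
    intro r r' hrr
    by_contra hne
    obtain ⟨l, hl⟩ := hs r r' hne
    simp [h, hrr] at hl
  refine ⟨Equiv.ofBijective f (Finite.injective_iff_bijective.1 hf), ?_⟩
  funext r s
  exact (h r s).symm

/-- On a compact set of connectivity matrices avoiding the relabellings of `π*`, the excess of the
cross-entropy is bounded away from zero, for every assignment of classes. -/
lemma exists_gap {Q : ℕ} {ζ : ℝ} (hζ : 0 < ζ) {πs : Connectivity Q} (hs : A1 πs) (hs2 : A2 ζ πs)
    {B : Set (Connectivity Q)} (hB : IsCompact B) (hB2 : ∀ π ∈ B, A2 ζ π)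
    (hBne : ∀ π ∈ B, ∀ σ, relabel σ π ≠ πs) :
    ∃ δ > 0, ∀ π ∈ B, ∀ f : Fin Q → Fin Q,
      δ ≤ ∑ r, ∑ s, excess ζ (πs r s) (π (f r) (f s)) := by
  have key : ∀ f : Fin Q → Fin Q, ∃ δ > 0, ∀ π ∈ B,
      δ ≤ ∑ r, ∑ s, excess ζ (πs r s) (π (f r) (f s)) := by
    intro f
    refine hB.exists_forall_le' (Continuous.continuousOn ?_) fun π hπ => ?_
    · refine continuous_finsetSum _ fun r _ => continuous_finsetSum _ fun s _ => ?_
      exact (continuous_excess ζ _).comp (by fun_prop)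
    · have hnn : ∀ r s, 0 ≤ excess ζ (πs r s) (π (f r) (f s)) := fun r s =>
        excess_nonneg hζ (hs2.eq_zero_or_one_or_mem_Icc r s)
          ((hB2 π hπ).eq_zero_or_one_or_mem_Icc _ _)
      -- If all entries agreed, `f` would be a permutation and `π` a relabelling of `πs`, which `B`
      -- excludes.
      obtain ⟨r, s, hrs⟩ : ∃ r s, πs r s ≠ π (f r) (f s) := by
        by_contra! hcon
        obtain ⟨σ, hσ⟩ := exists_relabel_eq hs f hcon
        exact hBne π hπ σ hσ
      refine Finset.sum_pos' (fun r _ => Finset.sum_nonneg fun s _ => hnn r s)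
        ⟨r, Finset.mem_univ r, Finset.sum_pos' (fun s _ => hnn r s) ⟨s, Finset.mem_univ s, ?_⟩⟩
      exact excess_pos hζ (hs2.eq_zero_or_one_or_mem_Icc r s)
          ((hB2 π hπ).eq_zero_or_one_or_mem_Icc _ _) fun h => hrs (Subtype.ext h)
  choose δ hδ hδB using key
  have hne : (Finset.univ : Finset (Fin Q → Fin Q)).Nonempty := ⟨id, Finset.mem_univ _⟩
  refine ⟨Finset.univ.inf' hne δ, (Finset.lt_inf'_iff hne).2 fun f _ => hδ f, fun π hπ f => ?_⟩
  exact (Finset.inf'_le δ (Finset.mem_univ f)).trans (hδB f π hπ)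

/-- The number of ordered pairs of distinct vertices in `S × T`. -/
lemma le_card_offDiag_filter {n : ℕ} (S T : Finset (Fin n)) {k : ℝ} (hk : 1 ≤ k)
    (hS : k ≤ S.card) (hT : k ≤ T.card) :
    k * (k - 1) ≤ (((Finset.univ : Finset (Fin n)).offDiag.filter
      fun p => p.1 ∈ S ∧ p.2 ∈ T).card : ℝ) := by
  -- Only diagonal pairs are lost, at most `S.card` of them; what remains is at least `S.card *
  -- (T.card - 1)`.
  have hsub : S ×ˢ T ⊆ ((Finset.univ : Finset (Fin n)).offDiag.filter
      fun p => p.1 ∈ S ∧ p.2 ∈ T) ∪ S.image fun i => (i, i) := by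
    rintro ⟨i, j⟩ hij
    simp only [Finset.mem_product] at hij
    by_cases h : i = j
    · subst h; simp [hij]
    · simp [hij, h]
  have h1 := (Finset.card_le_card hsub).trans (Finset.card_union_le _ _)
  rw [Finset.card_product] at h1
  have h2 := h1.trans (add_le_add_right (Finset.card_image_le (s := S)) _)
  have h3 : (S.card : ℝ) * T.card ≤ (((Finset.univ : Finset (Fin n)).offDiag.filter
      fun p => p.1 ∈ S ∧ p.2 ∈ T).card : ℝ) + S.card := by exact_mod_cast h2
  nlinarith

/-- A quadratic lower bound on the total excess, when all true classes are large. -/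
lemma le_sum_excess {Q n : ℕ} {ζ : ℝ} (hζ : 0 < ζ) {π πs : Connectivity Q} (h2 : A2 ζ π)
    (hs2 : A2 ζ πs) {δ : ℝ}
    (hδ : ∀ f : Fin Q → Fin Q, δ ≤ ∑ r, ∑ s, excess ζ (πs r s) (π (f r) (f s)))
    (z zs : Fin n → Fin Q) {k : ℝ} (hk : 1 ≤ k)
    (hcard : ∀ r, Q * k ≤ (Finset.univ.filter fun i => zs i = r).card) :
    k * (k - 1) * δ ≤ ∑ p ∈ (Finset.univ : Finset (Fin n)).offDiag,
      excess ζ (πs (zs p.1) (zs p.2)) (π (z p.1) (z p.2)) := by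
  have hnn : ∀ a b c d, 0 ≤ excess ζ (πs a b) (π c d) := fun a b c d =>
    excess_nonneg hζ (hs2.eq_zero_or_one_or_mem_Icc _ _) (h2.eq_zero_or_one_or_mem_Icc _ _)
  -- Pigeonhole: `z` splits a true class of size at least `Q * k` into `Q` pieces, one of which has
  -- size at least `k`. Its label becomes `f r`.
  have key : ∀ r, ∃ q, k ≤ ((Finset.univ.filter fun i => zs i = r).filter
      fun i => z i = q).card := by
    intro r
    obtain ⟨q, -, hq⟩ := Finset.exists_le_card_fiber_of_nsmul_le_card_of_maps_to
      (s := Finset.univ.filter fun i => zs i = r) (t := Finset.univ) (f := z) (b := k)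
      (fun _ _ => Finset.mem_univ _) ⟨r, Finset.mem_univ r⟩ (by simpa using hcard r)
    exact ⟨q, hq⟩
  choose f hf using key
  set S : Fin Q → Finset (Fin n) := fun r => (Finset.univ.filter fun i => zs i = r).filter
      fun i => z i = f r with hS
  have hkk : 0 ≤ k * (k - 1) := mul_nonneg (by linarith) (by linarith)
  calc k * (k - 1) * δ
      ≤ k * (k - 1) * ∑ r, ∑ s, excess ζ (πs r s) (π (f r) (f s)) :=
        mul_le_mul_of_nonneg_left (hδ f) hkk
    _ = ∑ c : Fin Q × Fin Q, k * (k - 1) * excess ζ (πs c.1 c.2) (π (f c.1) (f c.2)) := by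
        rw [← Finset.mul_sum, Fintype.sum_prod_type]
    _ ≤ ∑ c : Fin Q × Fin Q, ∑ p ∈ (Finset.univ : Finset (Fin n)).offDiag with
          (zs p.1, zs p.2) = c, excess ζ (πs (zs p.1) (zs p.2)) (π (z p.1) (z p.2)) := by
        refine Finset.sum_le_sum fun c _ => ?_
        calc k * (k - 1) * excess ζ (πs c.1 c.2) (π (f c.1) (f c.2))
            ≤ (((Finset.univ : Finset (Fin n)).offDiag.filter
                fun p => p.1 ∈ S c.1 ∧ p.2 ∈ S c.2).card : ℝ) *
                excess ζ (πs c.1 c.2) (π (f c.1) (f c.2)) :=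
              mul_le_mul_of_nonneg_right
                (le_card_offDiag_filter _ _ hk (hf c.1) (hf c.2)) (hnn _ _ _ _)
          _ = ∑ p ∈ (Finset.univ : Finset (Fin n)).offDiag with p.1 ∈ S c.1 ∧ p.2 ∈ S c.2,
                excess ζ (πs (zs p.1) (zs p.2)) (π (z p.1) (z p.2)) := by
              rw [← nsmul_eq_mul, ← Finset.sum_const]
              refine Finset.sum_congr rfl fun p hp => ?_
              simp only [hS, Finset.mem_filter, Finset.mem_univ, true_and] at hp
              obtain ⟨-, ⟨h1, h2⟩, h3, h4⟩ := hp
              rw [h1, h2, h3, h4]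
          _ ≤ _ := by
              -- Pairs outside the chosen pieces may be discarded because every excess is
              -- nonnegative.
              refine Finset.sum_le_sum_of_subset_of_nonneg ?_ fun _ _ _ => hnn _ _ _ _
              intro p hp
              simp only [hS, Finset.mem_filter, Finset.mem_univ, true_and] at hp ⊢
              exact ⟨hp.1, Prod.ext hp.2.1.1 hp.2.2.1⟩
    _ = _ := Finset.sum_fiberwise _ _ _

/-! ### Deterministic comparison with the truth -/

/-- The deviation of the number of edges from `A` to `B` from its conditional mean. -/
noncomputable def edgeDev {Q n : ℕ} (x : Fin n → Fin n → Bool) (zs : Fin n → Fin Q)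
    (πs : Connectivity Q) (A B : Finset (Fin n)) : ℝ :=
  ∑ p ∈ (Finset.univ : Finset (Fin n)).offDiag with p.1 ∈ A ∧ p.2 ∈ B,
    ((if x p.1 p.2 then 1 else 0) - (πs (zs p.1) (zs p.2) : ℝ))

/-- The truncated log-likelihood is uniformly close to its conditional mean. -/
lemma abs_sum_truncLog_sub_le {Q n : ℕ} {ζ : ℝ} (hζ : 0 < ζ) (x : Fin n → Fin n → Bool)
    (z zs : Fin n → Fin Q) (π πs : Connectivity Q) {M : ℝ}
    (hM : ∀ A B, |edgeDev x zs πs A B| ≤ M) :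
    |∑ p ∈ (Finset.univ : Finset (Fin n)).offDiag,
        truncLog ζ (bern (π (z p.1) (z p.2)) (x p.1 p.2)) -
      ∑ p ∈ (Finset.univ : Finset (Fin n)).offDiag,
        crossEnt ζ (πs (zs p.1) (zs p.2)) (π (z p.1) (z p.2))| ≤
      (Q : ℝ) ^ 2 * (1 / ζ * M) := by
  rw [← Finset.sum_sub_distrib]
  -- A function of a single bit is affine in it, so the centred term is a coefficient times the
  -- centred edge. The coefficient depends only on the pair of `z`-labels, and grouping by that pair
  -- leaves `Q ^ 2` edge deviations.
  have e1 : ∀ p : Fin n × Fin n, truncLog ζ (bern (π (z p.1) (z p.2)) (x p.1 p.2)) -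
      crossEnt ζ (πs (zs p.1) (zs p.2)) (π (z p.1) (z p.2)) =
      (truncLog ζ (π (z p.1) (z p.2)) - truncLog ζ (1 - π (z p.1) (z p.2))) *
      ((if x p.1 p.2 then 1 else 0) - (πs (zs p.1) (zs p.2) : ℝ)) := by
    intro p
    cases x p.1 p.2
    · simp only [bern, crossEnt, Bool.false_eq_true, if_false]
      ring
    · simp only [bern, crossEnt, if_true]
      ring
  rw [Finset.sum_congr rfl fun p _ => e1 p,
    ← Finset.sum_fiberwise _ (fun p : Fin n × Fin n => (z p.1, z p.2))]
  refine (Finset.abs_sum_le_sum_abs _ _).trans ?_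
  have e2 : ∀ c ∈ (Finset.univ : Finset (Fin Q × Fin Q)),
      |∑ p ∈ (Finset.univ : Finset (Fin n)).offDiag with (z p.1, z p.2) = c,
        (truncLog ζ (π (z p.1) (z p.2)) - truncLog ζ (1 - π (z p.1) (z p.2))) *
        ((if x p.1 p.2 then 1 else 0) - (πs (zs p.1) (zs p.2) : ℝ))| ≤ 1 / ζ * M := by
    rintro ⟨q, l⟩ -
    have e3 : ∑ p ∈ (Finset.univ : Finset (Fin n)).offDiag with (z p.1, z p.2) = (q, l),
        (truncLog ζ (π (z p.1) (z p.2)) - truncLog ζ (1 - π (z p.1) (z p.2))) *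
        ((if x p.1 p.2 then 1 else 0) - (πs (zs p.1) (zs p.2) : ℝ)) =
        (truncLog ζ (π q l) - truncLog ζ (1 - π q l)) *
          edgeDev x zs πs (Finset.univ.filter fun i => z i = q)
            (Finset.univ.filter fun i => z i = l) := by
      rw [edgeDev, Finset.mul_sum]
      refine Finset.sum_congr (Finset.filter_congr fun p _ => by simp) fun p hp => ?_
      obtain ⟨-, h1, h2⟩ := by simpa using hp
      rw [h1, h2]
    rw [e3, abs_mul]
    refine mul_le_mul ?_ (hM _ _) (abs_nonneg _) (by positivity)
    -- Both truncated logarithms lie in `[-1/ζ, 0]`, so their difference is at most `1/ζ` in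
    -- absolute value.
    have b1 := truncLog_nonpos hζ (π q l).2.2
    have b2 := truncLog_nonpos hζ (by linarith [(π q l).2.1] : 1 - (π q l : ℝ) ≤ 1)
    have b3 := neg_inv_le_truncLog ζ (π q l)
    have b4 := neg_inv_le_truncLog ζ (1 - π q l)
    rw [abs_le]
    constructor <;> linarith
  refine (Finset.sum_le_sum e2).trans (le_of_eq ?_)
  simp [sq]

/-- Deterministic comparison: for a typical graph, the criterion is smaller at `θ` than at the true
parameter. -/
lemma varSup_lt_varSup {Q n : ℕ} {ζ γ : ℝ} (hζ : 0 < ζ) (hγ : 0 < γ) (x : Fin n → Fin n → Bool)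
    (zs : Fin n → Fin Q) {θ θs : Param Q} (hθ : θ ∈ paramA23 Q ζ γ) (hθs : θs ∈ paramA23 Q ζ γ)
    (hw : 0 < weight x zs θs.1 θs.2) {M G : ℝ} (hM : ∀ A B, |edgeDev x zs θs.2 A B| ≤ M)
    (hG : ∀ z : Fin n → Fin Q, G ≤ ∑ p ∈ (Finset.univ : Finset (Fin n)).offDiag,
      excess ζ (θs.2 (zs p.1) (zs p.2)) (θ.2 (z p.1) (z p.2)))
    (hlt : 2 * ((Q : ℝ) ^ 2 * (1 / ζ * M)) - G < n * Real.log γ) :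
    varSup x θ < varSup x θs := by
  set H := ∑ p ∈ (Finset.univ : Finset (Fin n)).offDiag,
    crossEnt ζ (θs.2 (zs p.1) (zs p.2)) (θs.2 (zs p.1) (zs p.2)) with hH
  set N := (Q : ℝ) ^ 2 * (1 / ζ * M) with hN
  have hup : varSup x θ ≤ ((H + N - G : ℝ) : EReal) := by
    refine varSup_le_of_edgeProd_le x hθ.1 fun z => ?_
    calc edgeProd x z θ.2
        ≤ ∏ p ∈ (Finset.univ : Finset (Fin n)).offDiag,
            Real.exp (truncLog ζ (bern (θ.2 (z p.1) (z p.2)) (x p.1 p.2))) :=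
          Finset.prod_le_prod (fun _ _ => bern_nonneg _ _) fun _ _ => le_exp_truncLog _ _
      _ = Real.exp (∑ p ∈ (Finset.univ : Finset (Fin n)).offDiag,
            truncLog ζ (bern (θ.2 (z p.1) (z p.2)) (x p.1 p.2))) := (Real.exp_sum _ _).symm
      _ ≤ Real.exp (H + N - G) := by
          have h1 := (abs_le.1 (abs_sum_truncLog_sub_le hζ x z zs θ.2 θs.2 hM)).2
          have h2 := hG z
          simp only [excess, Finset.sum_sub_distrib] at h2
          exact Real.exp_le_exp.2 (by linarith)
  refine hup.trans_lt (lt_of_lt_of_le ?_ (log_weight_le_varSup x zs θs hθs.1.1 hw))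
  rw [EReal.coe_lt_coe_iff]
  have hαpos : ∀ q, 0 < θs.1 q := fun q => hγ.trans_le (hθs.2.2 q).1
  have hαp : 0 < ∏ i, θs.1 (zs i) := Finset.prod_pos fun i _ => hαpos _
  have hep : edgeProd x zs θs.2 ≠ 0 := fun h => by simp [weight, h] at hw
  rw [weight, Real.log_mul hαp.ne' hep, Real.log_prod fun i _ => (hαpos _).ne', edgeProd,
    Real.log_prod fun p hp => Finset.prod_ne_zero_iff.1 hep p hp]
  have hα : (n : ℝ) * Real.log γ ≤ ∑ i, Real.log (θs.1 (zs i)) := by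
    have := Finset.card_nsmul_le_sum (Finset.univ : Finset (Fin n))
      (fun i => Real.log (θs.1 (zs i))) (Real.log γ)
      fun i _ => Real.log_le_log hγ (hθs.2.2 _).1
    simpa using this
  -- At the truth the truncation is inactive: a positive weight rules out zero factors, and by (A2)
  -- the others are `1` or at least `ζ`.
  have htr : ∑ p ∈ (Finset.univ : Finset (Fin n)).offDiag,
      truncLog ζ (bern (θs.2 (zs p.1) (zs p.2)) (x p.1 p.2)) =
      ∑ p ∈ (Finset.univ : Finset (Fin n)).offDiag,
      Real.log (bern (θs.2 (zs p.1) (zs p.2)) (x p.1 p.2)) := by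
    refine Finset.sum_congr rfl fun p hp => ?_
    have h0 := Finset.prod_ne_zero_iff.1 hep p hp
    rcases hθs.2.1.eq_zero_or_one_or_mem_Icc (zs p.1) (zs p.2) with h | h | h
    · cases hx : x p.1 p.2
      · simp [bern, h, truncLog_one hζ]
      · simp [bern, h, hx] at h0
    · cases hx : x p.1 p.2
      · simp [bern, h, hx] at h0
      · simp [bern, h, truncLog_one hζ]
    · refine truncLog_of_le hζ ?_
      cases x p.1 p.2
      · simpa [bern] using by linarith [h.2]
      · simpa [bern] using h.1
  have h1 := (abs_le.1 (abs_sum_truncLog_sub_le hζ x zs zs θs.2 θs.2 hM)).1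
  linarith

/-! ### Exponential moments -/

/-- The exponential moment of a centred Bernoulli variable. -/
lemma bernoulli_mgf_le {p u : ℝ} (h0 : 0 ≤ p) (h1 : p ≤ 1) (hu : |u| ≤ 1) :
    p * Real.exp (u * (1 - p)) + (1 - p) * Real.exp (u * (0 - p)) ≤ Real.exp (u ^ 2) := by
  -- After averaging, the linear terms cancel by centring and leave `1 + u ^ 2`.
  have key : ∀ v : ℝ, |v| ≤ 1 → Real.exp (u * v) ≤ 1 + u * v + u ^ 2 := by
    intro v hv
    have huv : |u * v| ≤ 1 := by
      rw [abs_mul]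
      exact mul_le_one₀ hu (abs_nonneg v) hv
    have h2 := (abs_le.1 (Real.abs_exp_sub_one_sub_id_le huv)).2
    have hv2 : v ^ 2 ≤ 1 := (sq_le_one_iff_abs_le_one v).2 hv
    have : (u * v) ^ 2 ≤ u ^ 2 := by
      rw [mul_pow]
      exact mul_le_of_le_one_right (sq_nonneg u) hv2
    linarith
  have k1 := key (1 - p) (abs_le.2 ⟨by linarith, by linarith⟩)
  have k2 := key (0 - p) (abs_le.2 ⟨by linarith, by linarith⟩)
  calc p * Real.exp (u * (1 - p)) + (1 - p) * Real.exp (u * (0 - p))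
      ≤ p * (1 + u * (1 - p) + u ^ 2) + (1 - p) * (1 + u * (0 - p) + u ^ 2) :=
        add_le_add (mul_le_mul_of_nonneg_left k1 h0)
          (mul_le_mul_of_nonneg_left k2 (sub_nonneg.2 h1))
    _ = u ^ 2 + 1 := by ring
    _ ≤ Real.exp (u ^ 2) := Real.add_one_le_exp _

/-- The matrix of edge probabilities given the labels, with zero diagonal. -/
noncomputable def edgeProb {Q n : ℕ} (z : Fin n → Fin Q) (π : Connectivity Q) (i j : Fin n) : ℝ :=
  if i = j then 0 else π (z i) (z j)

lemma edgeProb_mem {Q n : ℕ} (z : Fin n → Fin Q) (π : Connectivity Q) (i j : Fin n) :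
    0 ≤ edgeProb z π i j ∧ edgeProb z π i j ≤ 1 := by
  unfold edgeProb
  split_ifs
  · norm_num
  · exact (π (z i) (z j)).2

/-- Giving loops probability zero makes the diagonal factors `1`. The full product over `i` and `j`
then factorizes when summed over all Boolean matrices. -/
lemma edgeProd_eq_prod {Q n : ℕ} {x : Fin n → Fin n → Bool} (hx : ∀ i, x i i = false)
    (z : Fin n → Fin Q) (π : Connectivity Q) :
    edgeProd x z π = ∏ i, ∏ j, bern (edgeProb z π i j) (x i j) := by
  rw [← Fintype.prod_prod_type' (f := fun i j => bern (edgeProb z π i j) (x i j)), edgeProd]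
  refine (Finset.prod_congr rfl fun p hp => ?_).trans
    (Finset.prod_subset (Finset.subset_univ _) fun p _ hp => ?_)
  · rw [edgeProb, if_neg (Finset.mem_offDiag.1 hp).2.2]
  · have : p.1 = p.2 := by simpa using hp
    simp [edgeProb, this, hx, bern]

/-- The conditional exponential moment of a sum of centred edge variables. -/
lemma sum_exp_edges_le {Q n : ℕ} (z : Fin n → Fin Q) (π : Connectivity Q) (c : Fin n → Fin n → ℝ)
    {u : ℝ} (hu : u ≤ 1) (hc : ∀ i j, |c i j| ≤ u) :
    ∑ x : Fin n → Fin n → Bool, (∏ i, ∏ j, bern (edgeProb z π i j) (x i j)) *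
      Real.exp (∑ i, ∑ j, c i j * ((if x i j then 1 else 0) - edgeProb z π i j)) ≤
      Real.exp (n ^ 2 * u ^ 2) := by
  have e1 : ∀ x : Fin n → Fin n → Bool, (∏ i, ∏ j, bern (edgeProb z π i j) (x i j)) *
      Real.exp (∑ i, ∑ j, c i j * ((if x i j then 1 else 0) - edgeProb z π i j)) =
      ∏ i, ∏ j, (bern (edgeProb z π i j) (x i j) *
        Real.exp (c i j * ((if x i j then 1 else 0) - edgeProb z π i j))) := by
    intro x
    simp only [Real.exp_sum, Finset.prod_mul_distrib]
  rw [Finset.sum_congr rfl fun x _ => e1 x, ← Fintype.prod_sum (fun i (y : Fin n → Bool) =>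
    ∏ j, (bern (edgeProb z π i j) (y j) *
        Real.exp (c i j * ((if y j then 1 else 0) - edgeProb z π i j))))]
  have e2 : ∀ i, ∑ y : Fin n → Bool, ∏ j, (bern (edgeProb z π i j) (y j) *
        Real.exp (c i j * ((if y j then 1 else 0) - edgeProb z π i j))) =
      ∏ j, ∑ b : Bool, (bern (edgeProb z π i j) b *
        Real.exp (c i j * ((if b then 1 else 0) - edgeProb z π i j))) := fun i =>
    (Fintype.prod_sum (fun j (b : Bool) => bern (edgeProb z π i j) b *
        Real.exp (c i j * ((if b then 1 else 0) - edgeProb z π i j)))).symm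
  rw [Finset.prod_congr rfl fun i _ => e2 i]
  have e3 : ∀ i j, ∑ b : Bool, (bern (edgeProb z π i j) b *
        Real.exp (c i j * ((if b then 1 else 0) - edgeProb z π i j))) ≤ Real.exp (u ^ 2) := by
    intro i j
    obtain ⟨h0, h1⟩ := edgeProb_mem z π i j
    have h2 := bernoulli_mgf_le h0 h1 ((hc i j).trans hu)
    have h3 : c i j ^ 2 ≤ u ^ 2 := sq_le_sq' (abs_le.1 (hc i j)).1 (abs_le.1 (hc i j)).2
    rw [Fintype.sum_bool]
    simp only [bern, if_true, Bool.false_eq_true, if_false]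
    exact h2.trans (Real.exp_le_exp.2 h3)
  have e4 : ∀ i j, 0 ≤ ∑ b : Bool, (bern (edgeProb z π i j) b *
        Real.exp (c i j * ((if b then 1 else 0) - edgeProb z π i j))) := by
    intro i j
    obtain ⟨h0, h1⟩ := edgeProb_mem z π i j
    refine Finset.sum_nonneg fun b _ => mul_nonneg ?_ (Real.exp_pos _).le
    cases b
    · simpa [bern] using h1
    · simpa [bern] using h0
  calc _ ≤ ∏ i : Fin n, ∏ j : Fin n, Real.exp (u ^ 2) :=
        Finset.prod_le_prod (fun i _ => Finset.prod_nonneg fun j _ => e4 i j)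
          fun i _ => Finset.prod_le_prod (fun j _ => e4 i j) fun j _ => e3 i j
    _ = Real.exp (n ^ 2 * u ^ 2) := by
        simp only [Finset.prod_const, Finset.card_univ, Fintype.card_fin, ← Real.exp_nat_mul]
        congr 1
        ring

lemma sum_exp_labels_le {Q n : ℕ} {α : Fin Q → ℝ} (hα : α ∈ stdSimplex ℝ (Fin Q)) (r : Fin Q)
    {u : ℝ} (hu : |u| ≤ 1) :
    ∑ z : Fin n → Fin Q, (∏ i, α (z i)) *
      Real.exp (∑ i, u * ((if z i = r then 1 else 0) - α r)) ≤ Real.exp (n * u ^ 2) := by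
  have e1 : ∀ z : Fin n → Fin Q, (∏ i, α (z i)) *
      Real.exp (∑ i, u * ((if z i = r then 1 else 0) - α r)) =
      ∏ i, (α (z i) * Real.exp (u * ((if z i = r then 1 else 0) - α r))) := by
    intro z
    simp only [Real.exp_sum, Finset.prod_mul_distrib]
  rw [Finset.sum_congr rfl fun z _ => e1 z, ← Fintype.prod_sum (fun (_ : Fin n) (q : Fin Q) =>
    α q * Real.exp (u * ((if q = r then 1 else 0) - α r)))]
  have hsum := Finset.add_sum_erase Finset.univ α (Finset.mem_univ r)
  rw [hα.2] at hsum
  have h1 : α r ≤ 1 := by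
    have := Finset.sum_nonneg fun q (_ : q ∈ Finset.univ.erase r) => hα.1 q
    linarith
  have e2 : ∑ q, α q * Real.exp (u * ((if q = r then 1 else 0) - α r)) ≤ Real.exp (u ^ 2) := by
    rw [← Finset.add_sum_erase _ _ (Finset.mem_univ r)]
    have : ∑ q ∈ Finset.univ.erase r, α q * Real.exp (u * ((if q = r then 1 else 0) - α r)) =
        (1 - α r) * Real.exp (u * (0 - α r)) := by
      rw [← hsum, add_sub_cancel_left, Finset.sum_mul]
      exact Finset.sum_congr rfl fun q hq => by rw [if_neg (Finset.ne_of_mem_erase hq)]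
    rw [this, if_pos rfl]
    exact bernoulli_mgf_le (hα.1 r) h1 hu
  calc _ ≤ ∏ _i : Fin n, Real.exp (u ^ 2) :=
        Finset.prod_le_prod (fun _ _ => Finset.sum_nonneg fun q _ =>
          mul_nonneg (hα.1 q) (Real.exp_pos _).le) fun _ _ => e2
    _ = Real.exp (n * u ^ 2) := by
        simp only [Finset.prod_const, Finset.card_univ, Fintype.card_fin, ← Real.exp_nat_mul]

/-! ### Concentration of edge counts and class sizes -/

section Concentration

variable {Ω : Type*} [MeasurableSpace Ω] {μ : Measure Ω} {Q : ℕ} {α : Fin Q → ℝ}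
  {π : Connectivity Q} {Z : ℕ → Ω → Fin Q} {X : ℕ → ℕ → Ω → Bool}

/-- A union bound over the finitely many values of labels and graph, each having the mass prescribed
by the model; the event itself need not be shown measurable. -/
lemma IsSBM.measure_le_sum (h : IsSBM μ α π Z X) (n : ℕ)
    (G : (Fin n → Fin Q) → (Fin n → Fin n → Bool) → Prop)
    (w : (Fin n → Fin Q) → (Fin n → Fin n → Bool) → ENNReal)
    (hw : ∀ z x, (∀ i, x i i = false) → G z x → ENNReal.ofReal (weight x z α π) ≤ w z x) :
    μ {ω | G (fun i => Z i ω) (observed X n ω)} ≤ ∑ z, ∑ x, w z x := by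
  have hsub : {ω | G (fun i => Z i ω) (observed X n ω)} ⊆
      ⋃ z : Fin n → Fin Q, ⋃ x : Fin n → Fin n → Bool,
        {ω | ((∀ i : Fin n, Z i ω = z i) ∧ ∀ i j : Fin n, X i j ω = x i j) ∧
          (∀ i, x i i = false) ∧ G z x} := by
    intro ω hω
    simp only [Set.mem_iUnion]
    exact ⟨fun i => Z i ω, observed X n ω, ⟨fun _ => rfl, fun _ _ => rfl⟩,
      fun i => h.no_loop i ω, hω⟩
  refine (measure_mono hsub).trans ((measure_iUnion_fintype_le _ _).trans
    (Finset.sum_le_sum fun z _ => (measure_iUnion_fintype_le _ _).trans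
      (Finset.sum_le_sum fun x _ => ?_)))
  by_cases hG : (∀ i, x i i = false) ∧ G z x
  · exact (measure_mono fun ω hω => hω.1).trans
      ((h.law n z x hG.1).trans_le (hw z x hG.1 hG.2))
  · simp [hG]

/-- Markov's inequality for the exponential of a statistic of the labels and the graph. -/
lemma IsSBM.measure_le_exp (h : IsSBM μ α π Z X) (hα : ∀ q, 0 ≤ α q) (n : ℕ)
    (G : (Fin n → Fin Q) → (Fin n → Fin n → Bool) → Prop)
    (Φ : (Fin n → Fin Q) → (Fin n → Fin n → Bool) → ℝ)
    (hΦ : ∀ z x, (∀ i, x i i = false) → G z x → 0 ≤ Φ z x) :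
    μ {ω | G (fun i => Z i ω) (observed X n ω)} ≤ ENNReal.ofReal
      (∑ z : Fin n → Fin Q, (∏ i, α (z i)) * ∑ x : Fin n → Fin n → Bool,
        (∏ i, ∏ j, bern (edgeProb z π i j) (x i j)) * Real.exp (Φ z x)) := by
  have hb : ∀ (z : Fin n → Fin Q) (x : Fin n → Fin n → Bool),
      0 ≤ ∏ i, ∏ j, bern (edgeProb z π i j) (x i j) := fun z x =>
    Finset.prod_nonneg fun i _ => Finset.prod_nonneg fun j _ =>
      bern_nonneg ⟨edgeProb z π i j, edgeProb_mem z π i j⟩ _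
  have hp : ∀ z : Fin n → Fin Q, 0 ≤ ∏ i, α (z i) := fun z =>
    Finset.prod_nonneg fun i _ => hα _
  have hnn : ∀ z x, 0 ≤ (∏ i, α (z i)) *
      ((∏ i, ∏ j, bern (edgeProb z π i j) (x i j)) * Real.exp (Φ z x)) := fun z x =>
    mul_nonneg (hp z) (mul_nonneg (hb z x) (Real.exp_pos _).le)
  refine (h.measure_le_sum n G (fun z x => ENNReal.ofReal ((∏ i, α (z i)) *
      ((∏ i, ∏ j, bern (edgeProb z π i j) (x i j)) * Real.exp (Φ z x)))) ?_).trans (le_of_eq ?_)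
  · intro z x hx hG
    refine ENNReal.ofReal_le_ofReal ?_
    rw [weight, edgeProd_eq_prod hx]
    exact mul_le_mul_of_nonneg_left (le_mul_of_one_le_right (hb z x)
      (Real.one_le_exp (hΦ z x hx hG))) (hp z)
  · simp only [Finset.mul_sum]
    rw [ENNReal.ofReal_sum_of_nonneg fun z _ => Finset.sum_nonneg fun x _ => hnn z x]
    exact Finset.sum_congr rfl fun z _ =>
      (ENNReal.ofReal_sum_of_nonneg fun x _ => hnn z x).symm

lemma IsSBM.measure_weight_nonpos (h : IsSBM μ α π Z X) (n : ℕ) :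
    μ {ω | weight (observed X n ω) (fun i => Z i ω) α π ≤ 0} = 0 := by
  refine le_antisymm ((h.measure_le_sum n (fun z x => weight x z α π ≤ 0) (fun _ _ => 0)
    fun z x _ hG => ?_).trans (by simp)) zero_le
  simp [ENNReal.ofReal_eq_zero.2 hG]

/-- Concentration of the number of edges between two sets of vertices. -/
lemma IsSBM.measure_edgeDev (h : IsSBM μ α π Z X) (hα : α ∈ stdSimplex ℝ (Fin Q)) (n : ℕ)
    (A B : Finset (Fin n)) {s : ℝ} (hs0 : 0 ≤ s) (hs2 : s ≤ 2) {e : ℝ} (he : |e| = 1) :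
    μ {ω | s * n ^ 2 < e * edgeDev (observed X n ω) (fun i => Z i ω) π A B} ≤
      ENNReal.ofReal (Real.exp (-(s ^ 2 / 4 * n ^ 2))) := by
  classical
  -- The Chernoff parameter `u = s / 2` minimizes `u ^ 2 - s * u`, whence the exponent `-s ^ 2 / 4`.
  let c : Fin n → Fin n → ℝ := fun i j => if i ≠ j ∧ i ∈ A ∧ j ∈ B then s / 2 * e else 0
  have hc : ∀ i j, |c i j| ≤ s / 2 := by
    intro i j
    simp only [c]
    split_ifs
    · rw [abs_mul, he, mul_one, abs_of_nonneg (by linarith)]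
    · simpa using by linarith
  have hdev : ∀ (z : Fin n → Fin Q) (x : Fin n → Fin n → Bool),
      ∑ i, ∑ j, c i j * ((if x i j then 1 else 0) - edgeProb z π i j) =
        s / 2 * (e * edgeDev x z π A B) := by
    intro z x
    rw [← Fintype.sum_prod_type' (f := fun i j =>
      c i j * ((if x i j then 1 else 0) - edgeProb z π i j)), edgeDev, ← mul_assoc,
      Finset.mul_sum]
    symm
    refine (Finset.sum_congr rfl fun p hp => ?_).trans
      (Finset.sum_subset (Finset.subset_univ _) fun p _ hp => ?_)
    · obtain ⟨h1, h2⟩ := Finset.mem_filter.1 hp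
      have h3 := (Finset.mem_offDiag.1 h1).2.2
      have h4 : c p.1 p.2 = s / 2 * e := if_pos ⟨h3, h2⟩
      have h5 : edgeProb z π p.1 p.2 = π (z p.1) (z p.2) := if_neg h3
      rw [h4, h5]
    · have : c p.1 p.2 = 0 := if_neg (by simpa using hp)
      simp only [this, zero_mul]
  refine (h.measure_le_exp hα.1 n (fun z x => s * n ^ 2 < e * edgeDev x z π A B)
    (fun z x => ∑ i, ∑ j, c i j * ((if x i j then 1 else 0) - edgeProb z π i j) +
      -(s / 2 * (s * n ^ 2))) ?_).trans (ENNReal.ofReal_le_ofReal ?_)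
  · intro z x _ hG
    rw [hdev]
    have := mul_le_mul_of_nonneg_left hG.le (by linarith : 0 ≤ s / 2)
    linarith
  · simp only [Real.exp_add, ← mul_assoc, ← Finset.sum_mul]
    have hsum : ∑ z : Fin n → Fin Q, ∏ i, α (z i) = 1 :=
      sum_prod_eq_one (τ := fun _ => α) fun _ => hα
    calc _ ≤ (∑ z : Fin n → Fin Q, (∏ i, α (z i)) * Real.exp (n ^ 2 * (s / 2) ^ 2)) *
          Real.exp (-(s / 2 * s * n ^ 2)) := by
          refine mul_le_mul_of_nonneg_right (Finset.sum_le_sum fun z _ => ?_) (Real.exp_pos _).le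
          exact mul_le_mul_of_nonneg_left (sum_exp_edges_le z π c (by linarith) hc)
            (Finset.prod_nonneg fun i _ => hα.1 _)
      _ = Real.exp (-(s ^ 2 / 4 * n ^ 2)) := by
          rw [← Finset.sum_mul, hsum, one_mul, ← Real.exp_add]
          congr 1
          ring

/-- Concentration of the class sizes. -/
lemma IsSBM.measure_card_class (h : IsSBM μ α π Z X) (hα : α ∈ stdSimplex ℝ (Fin Q)) (n : ℕ)
    (r : Fin Q) {s : ℝ} (hs0 : 0 ≤ s) (hs2 : s ≤ 2) :
    μ {ω | ((Finset.univ.filter fun i : Fin n => Z i ω = r).card : ℝ) < (α r - s) * n} ≤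
      ENNReal.ofReal (Real.exp (-(s ^ 2 / 4 * n))) := by
  have hdev : ∀ z : Fin n → Fin Q, ∑ i, -(s / 2) * ((if z i = r then 1 else 0) - α r) =
      s / 2 * (n * α r - ((Finset.univ.filter fun i : Fin n => z i = r).card : ℝ)) := by
    intro z
    rw [← Finset.mul_sum, Finset.sum_sub_distrib, Finset.sum_boole]
    simp only [Finset.sum_const, Finset.card_univ, Fintype.card_fin, nsmul_eq_mul]
    ring
  refine (h.measure_le_exp hα.1 n
    (fun z _ => ((Finset.univ.filter fun i : Fin n => z i = r).card : ℝ) < (α r - s) * n)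
    (fun z _ => ∑ i, -(s / 2) * ((if z i = r then 1 else 0) - α r) +
      -(s / 2 * (s * n))) ?_).trans (ENNReal.ofReal_le_ofReal ?_)
  · intro z x _ hG
    rw [hdev]
    have : s * n ≤ n * α r - ((Finset.univ.filter fun i : Fin n => z i = r).card : ℝ) := by
      linarith
    have := mul_le_mul_of_nonneg_left this (by linarith : 0 ≤ s / 2)
    linarith
  · have hx : ∀ z : Fin n → Fin Q, ∑ x : Fin n → Fin n → Bool,
        (∏ i, ∏ j, bern (edgeProb z π i j) (x i j)) ≤ 1 := by
      intro z
      -- With zero coefficients the exponential moment bound says that the total conditional mass is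
      -- at most one.
      have := sum_exp_edges_le z π (fun _ _ => 0) (u := 0) zero_le_one (by simp)
      simpa using this
    have hp : ∀ z : Fin n → Fin Q, 0 ≤ ∏ i, α (z i) := fun z =>
      Finset.prod_nonneg fun i _ => hα.1 _
    calc _ ≤ (∑ z : Fin n → Fin Q, (∏ i, α (z i)) *
          Real.exp (∑ i, -(s / 2) * ((if z i = r then 1 else 0) - α r))) *
          Real.exp (-(s / 2 * (s * n))) := by
          rw [Finset.sum_mul]
          refine Finset.sum_le_sum fun z _ => ?_
          rw [← Finset.sum_mul, Real.exp_add, mul_assoc]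
          refine mul_le_mul_of_nonneg_left ?_ (hp z)
          exact mul_le_of_le_one_left (by positivity) (hx z)
      _ ≤ Real.exp (n * (-(s / 2)) ^ 2) * Real.exp (-(s / 2 * (s * n))) := by
          refine mul_le_mul_of_nonneg_right (sum_exp_labels_le hα r ?_) (Real.exp_pos _).le
          rw [abs_neg, abs_of_nonneg (by linarith)]
          linarith
      _ = Real.exp (-(s ^ 2 / 4 * n)) := by
          rw [← Real.exp_add]
          congr 1
          ring

end Concentration

/-! ### The far set and typical graphs -/

/-- (A1) is an open condition, so adding its violators to the far set preserves compactness. -/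
lemma isClosed_not_A1 (Q : ℕ) : IsClosed {π : Connectivity Q | ¬ A1 π} := by
  have : {π : Connectivity Q | ¬ A1 π} = ⋃ q, ⋃ q', ⋃ (_ : q ≠ q'), ⋂ l,
      {π : Connectivity Q | π q l = π q' l} ∩ {π : Connectivity Q | π l q = π l q'} := by
    ext π
    simp [A1]
  rw [this]
  refine isClosed_iUnion_of_finite fun q => isClosed_iUnion_of_finite fun q' =>
    isClosed_iUnion_of_finite fun _ => isClosed_iInter fun l => ?_
  exact (isClosed_eq (by fun_prop) (by fun_prop)).inter (isClosed_eq (by fun_prop) (by fun_prop))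

lemma A1.of_relabel {Q : ℕ} {π : Connectivity Q} {σ : Equiv.Perm (Fin Q)}
    (h : A1 (relabel σ π)) : A1 π := by
  intro q q' hq
  obtain ⟨l, hl⟩ := h (σ.symm q) (σ.symm q') fun he => hq (σ.symm.injective he)
  exact ⟨σ l, by simpa [relabel] using hl⟩

lemma IsDistance.nonneg {Q : ℕ} {d : Connectivity Q → Connectivity Q → ℝ} (hd : IsDistance d)
    (x y : Connectivity Q) : 0 ≤ d x y := by
  have h1 := hd.triangle x y x
  rw [(hd.eq_zero_iff x x).2 rfl, hd.symm y x] at h1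
  linarith

/-- The matrices fulfilling (A2) that violate (A1) or are at distance at least `ε` from every
relabelling of `π*`. -/
def farSet {Q : ℕ} (ζ : ℝ) (d : Connectivity Q → Connectivity Q → ℝ) (πs : Connectivity Q)
    (ε : ℝ) : Set (Connectivity Q) :=
  {π | A2 ζ π ∧ (¬ A1 π ∨ ∀ σ, ε ≤ d (relabel σ π) πs)}

lemma isCompact_farSet {Q : ℕ} (ζ : ℝ) {d : Connectivity Q → Connectivity Q → ℝ}
    (hd : IsDistance d) (πs : Connectivity Q) (ε : ℝ) : IsCompact (farSet ζ d πs ε) := by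
  refine IsClosed.isCompact ((isClosed_A2 Q ζ).inter ((isClosed_not_A1 Q).union ?_))
  change IsClosed {π : Connectivity Q | ∀ σ, ε ≤ d (relabel σ π) πs}
  rw [Set.ofPred_forall]
  refine isClosed_iInter fun σ => isClosed_le continuous_const ?_
  have : Continuous fun π : Connectivity Q => (relabel σ π, πs) := by
    unfold relabel
    fun_prop
  exact hd.continuous.comp this

lemma relabel_ne_of_mem_farSet {Q : ℕ} {ζ : ℝ} {d : Connectivity Q → Connectivity Q → ℝ}
    (hd : IsDistance d) {πs : Connectivity Q} (hs : A1 πs) {ε : ℝ} (hε : 0 < ε)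
    {π : Connectivity Q} (hπ : π ∈ farSet ζ d πs ε) (σ : Equiv.Perm (Fin Q)) :
    relabel σ π ≠ πs := by
  intro h
  rcases hπ.2 with h1 | h1
  · exact h1 (A1.of_relabel (σ := σ) (h ▸ hs))
  · have := h1 σ
    rw [(hd.eq_zero_iff _ _).2 h] at this
    linarith

/-- The graphs and labels for which edge counts and class sizes are close to their means. -/
def Typical {Q n : ℕ} (γ s : ℝ) (θ : Param Q) (z : Fin n → Fin Q) (x : Fin n → Fin n → Bool) :
    Prop :=
  0 < weight x z θ.1 θ.2 ∧ (∀ A B, |edgeDev x z θ.2 A B| ≤ s * n ^ 2) ∧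
    ∀ r, γ / 2 * n ≤ (Finset.univ.filter fun i => z i = r).card

/-- For typical large graphs, parameters in the far set have a smaller criterion than the true
one. -/
lemma exists_typical_varSup_lt {Q : ℕ} {ζ γ : ℝ} (hζ : 0 < ζ) (hγ : 0 < γ) {θs : Param Q}
    (hθs : θs ∈ paramA123 Q ζ γ) {B : Set (Connectivity Q)} (hB : IsCompact B)
    (hB2 : ∀ π ∈ B, A2 ζ π) (hBne : ∀ π ∈ B, ∀ σ, relabel σ π ≠ θs.2) :
    ∃ s : ℝ, 0 < s ∧ s ≤ 2 ∧ ∀ᶠ n : ℕ in Filter.atTop,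
      ∀ (z : Fin n → Fin Q) (x : Fin n → Fin n → Bool), Typical γ s θs z x →
        ∀ θ ∈ paramA23 Q ζ γ, θ.2 ∈ B → varSup x θ < varSup x θs := by
  obtain ⟨δ, hδ, hgap⟩ := exists_gap hζ hθs.2 hθs.1.2.1 hB hB2 hBne
  have hQ : (0 : ℝ) < Q := by
    rcases Nat.eq_zero_or_pos Q with h | h
    · subst h
      simpa using hθs.1.1.2
    · exact_mod_cast h
  -- Chosen so that `Q * (κ * n) = γ / 2 * n`, the class size guaranteed on typical graphs.
  set κ := γ / (2 * Q) with hκ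
  have hκ0 : 0 < κ := by positivity
  -- This `s` keeps the two deviation terms below a quarter of `κ ^ 2 * δ * n ^ 2`; the cap `2` is
  -- what the Chernoff bounds require.
  refine ⟨min 2 (κ ^ 2 * δ * ζ / (8 * Q ^ 2)), by positivity, min_le_left _ _, ?_⟩
  set s := min 2 (κ ^ 2 * δ * ζ / (8 * Q ^ 2)) with hs
  have hsQ : 2 * ((Q : ℝ) ^ 2 * (1 / ζ * s)) ≤ κ ^ 2 * δ / 4 := by
    calc 2 * ((Q : ℝ) ^ 2 * (1 / ζ * s))
        ≤ 2 * ((Q : ℝ) ^ 2 * (1 / ζ * (κ ^ 2 * δ * ζ / (8 * Q ^ 2)))) := by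
          gcongr
          exact min_le_right _ _
      _ = κ ^ 2 * δ / 4 := by field_simp; norm_num
  have t1 : ∀ᶠ n : ℕ in Filter.atTop, 1 / κ ≤ (n : ℝ) :=
    tendsto_natCast_atTop_atTop.eventually_ge_atTop _
  -- Three quarters of the quadratic gap must absorb the linear loss `κ * δ * n` from the diagonal
  -- and the label cost `-n * log γ`.
  have t2 : ∀ᶠ n : ℕ in Filter.atTop,
      (κ * δ - Real.log γ) / (3 / 4 * κ ^ 2 * δ) < (n : ℝ) :=
    tendsto_natCast_atTop_atTop.eventually_gt_atTop _
  filter_upwards [t1, t2, Filter.eventually_gt_atTop 0] with n h1 h2 h3 z x hT θ hθ hθB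
  have hn : (0 : ℝ) < n := by exact_mod_cast h3
  have hk : 1 ≤ κ * n := by rwa [div_le_iff₀' hκ0] at h1
  refine varSup_lt_varSup hζ hγ x z hθ hθs.1 hT.1 hT.2.1
    (G := κ * n * (κ * n - 1) * δ) (fun z' => ?_) ?_
  · refine le_sum_excess hζ (hB2 _ hθB) hθs.1.2.1 (hgap _ hθB) z' z hk fun r => ?_
    refine le_trans (le_of_eq ?_) (hT.2.2 r)
    rw [hκ]
    field_simp
  · rw [div_lt_iff₀' (by positivity)] at h2
    have e1 : 2 * ((Q : ℝ) ^ 2 * (1 / ζ * (s * n ^ 2))) ≤ κ ^ 2 * δ / 4 * n ^ 2 := by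
      calc _ = 2 * ((Q : ℝ) ^ 2 * (1 / ζ * s)) * n ^ 2 := by ring
        _ ≤ _ := mul_le_mul_of_nonneg_right hsQ (sq_nonneg _)
    have e2 := mul_lt_mul_of_pos_left h2 hn
    linarith

/-- The exponent is `n * (log 4 - s * n)`, so the quadratic term beats the union bound over `4 ^ n`
pairs of vertex sets. -/
lemma tendsto_exp_neg_sq {s : ℝ} (hs : 0 < s) :
    Filter.Tendsto (fun n : ℕ => (4 : ℝ) ^ n * Real.exp (-(s * n ^ 2))) Filter.atTop (nhds 0) := by
  have h1 : Filter.Tendsto (fun n : ℕ => (n : ℝ)) Filter.atTop Filter.atTop :=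
    tendsto_natCast_atTop_atTop
  have h2 : Filter.Tendsto (fun n : ℕ => Real.log 4 + -s * (n : ℝ)) Filter.atTop Filter.atBot :=
    Filter.tendsto_atBot_add_const_left _ _
      (h1.const_mul_atTop_of_neg (neg_neg_of_pos hs))
  refine (Real.tendsto_exp_atBot.comp (h1.atTop_mul_atBot₀ h2)).congr fun n => ?_
  rw [Function.comp_apply, mul_add, Real.exp_add, Real.exp_nat_mul, Real.exp_log (by norm_num)]
  congr 2
  ring

lemma tendsto_exp_neg {s : ℝ} (hs : 0 < s) :
    Filter.Tendsto (fun n : ℕ => Real.exp (-(s * n))) Filter.atTop (nhds 0) := by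
  refine Real.tendsto_exp_atBot.comp ?_
  simp only [← neg_mul]
  exact (tendsto_natCast_atTop_atTop).const_mul_atTop_of_neg (neg_neg_of_pos hs)

lemma IsSBM.tendsto_measure_not_typical {Ω : Type*} [MeasurableSpace Ω] {μ : Measure Ω} {Q : ℕ}
    {ζ γ s : ℝ} {θ : Param Q} {Z : ℕ → Ω → Fin Q} {X : ℕ → ℕ → Ω → Bool}
    (h : IsSBM μ θ.1 θ.2 Z X) (hγ : 0 < γ) (hθ : θ ∈ paramA23 Q ζ γ) (hs0 : 0 < s) (hs2 : s ≤ 2) :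
    Filter.Tendsto
      (fun n : ℕ => μ {ω | ¬ Typical (n := n) γ s θ (fun i => Z i ω) (observed X n ω)})
      Filter.atTop (nhds 0) := by
  have hbound : ∀ n : ℕ,
      μ {ω | ¬ Typical (n := n) γ s θ (fun i => Z i ω) (observed X n ω)} ≤
        ENNReal.ofReal (2 * ((4 : ℝ) ^ n * Real.exp (-(s ^ 2 / 4 * n ^ 2))) +
          Q * Real.exp (-((γ / 2) ^ 2 / 4 * n))) := by
    intro n
    have hsub : {ω | ¬ Typical (n := n) γ s θ (fun i => Z i ω) (observed X n ω)} ⊆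
        {ω | weight (observed X n ω) (fun i => Z i ω) θ.1 θ.2 ≤ 0} ∪
        ((⋃ A : Finset (Fin n), ⋃ B : Finset (Fin n),
          ({ω | s * n ^ 2 < 1 * edgeDev (observed X n ω) (fun i => Z i ω) θ.2 A B} ∪
            {ω | s * n ^ 2 < -1 * edgeDev (observed X n ω) (fun i => Z i ω) θ.2 A B})) ∪
        ⋃ r : Fin Q, {ω | ((Finset.univ.filter fun i : Fin n => Z i ω = r).card : ℝ) <
          (θ.1 r - γ / 2) * n}) := by
      intro ω hω
      simp only [Set.mem_union, Set.mem_iUnion]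
      by_contra hcon
      push Not at hcon
      obtain ⟨h1, h2, h3⟩ := hcon
      refine hω ⟨not_le.1 h1, fun A B => abs_le.2 ⟨?_, ?_⟩, fun r => ?_⟩
      · have : ¬ s * n ^ 2 < -1 * edgeDev (observed X n ω) (fun i => Z i ω) θ.2 A B := (h2 A B).2
        linarith
      · have : ¬ s * n ^ 2 < 1 * edgeDev (observed X n ω) (fun i => Z i ω) θ.2 A B := (h2 A B).1
        linarith
      · have h4 : ¬ ((Finset.univ.filter fun i : Fin n => Z i ω = r).card : ℝ) <
          (θ.1 r - γ / 2) * n := h3 r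
        refine le_trans ?_ (not_lt.1 h4)
        exact mul_le_mul_of_nonneg_right (by linarith [(hθ.2.2 r).1]) (Nat.cast_nonneg n)
    refine (measure_mono hsub).trans ((measure_union_le _ _).trans ?_)
    rw [h.measure_weight_nonpos, zero_add]
    refine (measure_union_le _ _).trans ?_
    rw [ENNReal.ofReal_add (by positivity) (by positivity)]
    refine add_le_add ?_ ?_
    · have hAB : ∀ A B : Finset (Fin n),
          μ ({ω | s * n ^ 2 < 1 * edgeDev (observed X n ω) (fun i => Z i ω) θ.2 A B} ∪
            {ω | s * n ^ 2 < -1 * edgeDev (observed X n ω) (fun i => Z i ω) θ.2 A B}) ≤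
          ENNReal.ofReal (2 * Real.exp (-(s ^ 2 / 4 * n ^ 2))) := by
        intro A B
        rw [two_mul, ENNReal.ofReal_add (Real.exp_pos _).le (Real.exp_pos _).le]
        exact (measure_union_le _ _).trans (add_le_add
          (h.measure_edgeDev hθ.1 n A B hs0.le hs2 (by simp))
          (h.measure_edgeDev hθ.1 n A B hs0.le hs2 (by simp)))
      refine (measure_iUnion_fintype_le _ _).trans ((Finset.sum_le_sum fun A _ =>
        (measure_iUnion_fintype_le _ _).trans (Finset.sum_le_sum fun B _ => hAB A B)).trans
          (le_of_eq ?_))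
      simp only [Finset.sum_const, Finset.card_univ, Fintype.card_finset, Fintype.card_fin,
        smul_smul]
      rw [← ENNReal.ofReal_nsmul, nsmul_eq_mul, ← mul_pow]
      congr 1
      push_cast
      ring
    · refine (measure_iUnion_fintype_le _ _).trans ((Finset.sum_le_sum fun r _ =>
        h.measure_card_class hθ.1 n r (by positivity) ?_).trans (le_of_eq ?_))
      · have := hθ.2.2 r
        linarith [this.1.trans this.2]
      · rw [Finset.sum_const, Finset.card_univ, Fintype.card_fin, ← ENNReal.ofReal_nsmul,
          nsmul_eq_mul]
  refine tendsto_of_tendsto_of_tendsto_of_le_of_le tendsto_const_nhds ?_ (fun _ => zero_le) hbound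
  have := ENNReal.tendsto_ofReal
    (((tendsto_exp_neg_sq (s := s ^ 2 / 4) (by positivity)).const_mul 2).add
      ((tendsto_exp_neg (s := (γ / 2) ^ 2 / 4) (by positivity)).const_mul (Q : ℝ)))
  simpa using this

end SBM

theorem mainTheorem6
    {Ω : Type*} [MeasurableSpace Ω] (μ : Measure Ω) [IsProbabilityMeasure μ]
    (Q : ℕ) (ζ γ : ℝ) (hζ : 0 < ζ) (hγ : 0 < γ) (hγQ : γ < 1 / (Q : ℝ))
    (αstar : Fin Q → ℝ) (πstar : SBM.Connectivity Q)
    (hstar : (αstar, πstar) ∈ SBM.paramA123 Q ζ γ)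
    (Z : ℕ → Ω → Fin Q) (X : ℕ → ℕ → Ω → Bool)
    (hX : SBM.IsSBM μ αstar πstar Z X)
    (Θ : Set (SBM.Param Q))
    (hΘ₁ : SBM.paramA123 Q ζ γ ⊆ Θ) (hΘ₂ : Θ ⊆ SBM.paramA23 Q ζ γ)
    (αtilde : ℕ → Ω → Fin Q → ℝ) (πtilde : ℕ → Ω → SBM.Connectivity Q)
    (hest : ∀ (n : ℕ) (ω : Ω),
      (∃ θ : SBM.Param Q, SBM.IsVariationalEstimate Θ (SBM.observed X n ω) θ) →
        SBM.IsVariationalEstimate Θ (SBM.observed X n ω) (αtilde n ω, πtilde n ω))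
    (d : SBM.Connectivity Q → SBM.Connectivity Q → ℝ) (hd : SBM.IsDistance d) :
    TendstoInMeasure μ
      (fun (n : ℕ) (ω : Ω) =>
        ⨅ σ : Equiv.Perm (Fin Q), d (SBM.relabel σ (πtilde n ω)) πstar)
      Filter.atTop (fun _ => (0 : ℝ)) := by
  rw [tendstoInMeasure_iff_norm]
  intro ε hε
  obtain ⟨s, hs0, hs2, hcomp⟩ := SBM.exists_typical_varSup_lt hζ hγ hstar
    (SBM.isCompact_farSet ζ hd πstar ε) (fun π hπ => hπ.1)
    (fun π hπ σ => SBM.relabel_ne_of_mem_farSet hd hstar.2 hε hπ σ)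
  have htyp := SBM.IsSBM.tendsto_measure_not_typical (θ := (αstar, πstar)) hX hγ hstar.1 hs0 hs2
  refine tendsto_of_tendsto_of_tendsto_of_le_of_le' tendsto_const_nhds htyp
    (Filter.Eventually.of_forall fun _ => zero_le) ?_
  filter_upwards [hcomp, Filter.eventually_ge_atTop 2] with n hn hn2
  -- The bad event is contained in the non-typical one: a typical graph with a distant estimate is
  -- contradictory.
  refine measure_mono fun ω hω hT => ?_
  have hnot : ∀ θ ∈ SBM.paramA23 Q ζ γ,
      SBM.varSup (SBM.observed X n ω) (αstar, πstar) ≤ SBM.varSup (SBM.observed X n ω) θ →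
        θ.2 ∉ SBM.farSet ζ d πstar ε :=
    fun θ hθ hle hfar => absurd hle (not_le.2 (hn _ _ hT θ hθ hfar))
  -- The maximizer is sought on the larger compact set because `Θ` need not be closed.
  obtain ⟨θm, hθm, hmax⟩ :=
    SBM.exists_isMaxOn_varSup hζ hγ (SBM.observed X n ω) ⟨_, hstar.1⟩
  have hm1 : SBM.A1 θm.2 := by
    by_contra h
    exact hnot θm hθm (hmax hstar.1) ⟨hθm.2.1, Or.inl h⟩
  -- By (A1), `θm` belongs to `Θ` and is maximal there, so the argmax is non-empty and the estimator
  -- is a genuine maximizer.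
  obtain ⟨hΘ, hopt⟩ := hest n ω ⟨θm, hΘ₁ ⟨hθm, hm1⟩, fun θ hθ =>
    (SBM.Jn_le_iff hn2 _ θ θm).2 (hmax (hΘ₂ hθ))⟩
  have hle := (SBM.Jn_le_iff hn2 (SBM.observed X n ω) (αstar, πstar) _).1 (hopt (hΘ₁ hstar))
  have hclose : ∃ σ, d (SBM.relabel σ (πtilde n ω)) πstar < ε := by
    by_contra! h
    exact hnot _ (hΘ₂ hΘ) hle ⟨(hΘ₂ hΘ).2.1, Or.inr h⟩
  obtain ⟨σ, hσ⟩ := hclose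
  have h1 : (⨅ σ : Equiv.Perm (Fin Q), d (SBM.relabel σ (πtilde n ω)) πstar) < ε :=
    (ciInf_le (Set.finite_range _).bddBelow σ).trans_lt hσ
  have h0 : 0 ≤ ⨅ σ : Equiv.Perm (Fin Q), d (SBM.relabel σ (πtilde n ω)) πstar :=
    Real.iInf_nonneg fun σ => hd.nonneg _ _
  have h2 : ε ≤ ‖(⨅ σ : Equiv.Perm (Fin Q), d (SBM.relabel σ (πtilde n ω)) πstar) - 0‖ := hω
  rw [sub_zero, Real.norm_of_nonneg h0] at h2
  linarith
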